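/- Let $K$ be a non-archimedean local field with valuation ring $\mathcal O_K$, finite residue field $k$ and module $q=|k|$. For $d\ge 1$ write $[d]=\{1,\dots,d\}$. Let $X=(X_1,\dots,X_d)$ be a Gaussian vector in $K^d$: if $X',X''$ are independent copies of $X$, then $(X',X'')$ and $(a_{11}X'+a_{12}X'',\,a_{21}X'+a_{22}X'')$ have the same law for every $(a_{ij})\in \mathrm{GL}_2(\mathcal O_K)$. Let $I\subsetneq[d]$. Then there is a matroid $M$ with ground set $[d]\setminus I$ whose bases are exactly the maximal subsets $J\subseteq[d]\setminus I$ such that $(X_j)_{j\in J}$ are mutually independent given $X_I=(X_i)_{i\in I}$, and $M$ is representable over $\mathbb F_q$. Suppose moreover that $X$ is non-degenerate, i.e. the support $L\subset K^d$ of its law (its lattice) spans $K^d$ over $K$. Fix a uniformizer $\pi$ and a set $\mathcal T\subset\mathcal O_K$ of representatives of $k$ containing $0$, and list the coordinates in an order in which those in $I$ come first. In this order $L=A\,\mathcal O_K^d$ for a unique matrix $A$ in Hermite normal form: $a_{ij}=0$ for $i<j$, $a_{ii}=\pi^{n_i}$ with $n_i\in\mathbb Z$, and for $j<i$ the entry $a_{ij}$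 is $0$ or a Laurent polynomial in $\pi$ with coefficients in $\mathcal T$ of degree less than $n_i$. Let $B$ be the lower right block of $A$ with rows and columns at the positions of $[d]\setminus I$. The rows of $B$ can be scaled by elements of $K$ so that each has norm $1$ (the norm of a row is the maximum of the absolute values of its entries), and for every matrix $C$ obtained in this way the rows of $C$, reduced mod $\pi$, realize $M$ over $k\cong\mathbb F_q$: a subset $J\subseteq[d]\setminus I$ is independent in $M$ if and only if the reduced rows of $C$ indexed by $J$ are linearly independent over $k$. -/

import Mathlib

open MeasureTheory ProbabilityTheory Set
open scoped ValuativeRel Matrix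

noncomputable section

namespace LocalFieldGaussian

/-! ### Gaussian vectors over a local field -/

section Gaussian

variable {K : Type*} [Field K] [ValuativeRel K] [MeasurableSpace K]
variable {ι : Type*} {Ω : Type*} [MeasurableSpace Ω]

/-- The action of a `2 × 2` matrix over `𝒪[K]` on pairs of vectors:
`(x₁, x₂) ↦ (a₁₁ x₁ + a₁₂ x₂, a₂₁ x₁ + a₂₂ x₂)`. -/
def pairAction (A : Matrix (Fin 2) (Fin 2) 𝒪[K]) (z : (ι → K) × (ι → K)) :
    (ι → K) × (ι → K) :=
  ((A 0 0 : K) • z.1 + (A 0 1 : K) • z.2, (A 1 0 : K) • z.1 + (A 1 1 : K) • z.2)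

/-- A random vector `X` in `K^ι` is (centered) Gaussian if the joint law of two independent
copies of `X` (the product of the law of `X` with itself) is invariant under `GL₂(𝒪[K])`. -/
structure IsGaussianVector (X : Ω → ι → K) (P : Measure Ω) : Prop where
  measurable : Measurable X
  map_eq : ∀ A : GL (Fin 2) 𝒪[K],
    ((P.map X).prod (P.map X)).map (pairAction (A : Matrix (Fin 2) (Fin 2) 𝒪[K]))
      = (P.map X).prod (P.map X)

/-- The lattice of a Gaussian vector: the support of its law. -/
def latticeOf [TopologicalSpace K] (X : Ω → ι → K) (P : Measure Ω) : Set (ι → K) :=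
  (P.map X).support

/-- `X` is non-degenerate if its lattice has full rank, that is, spans `K^ι`. -/
def IsNondegenerate [TopologicalSpace K] (X : Ω → ι → K) (P : Measure Ω) : Prop :=
  Submodule.span K (latticeOf X P) = ⊤

end Gaussian

/-! ### Mutual conditional independence -/

/-- The random variables `f i` are mutually independent given the sub-σ-algebra `m'`:
conditional probabilities of finite intersections factor almost surely. (On a standard Borel
space this is `ProbabilityTheory.iCondIndepFun`, by `ProbabilityTheory.iCondIndepFun_iff`;
here the probability space is arbitrary.) -/
def MutuallyCondIndep {Ω ι β : Type*} [MeasurableSpace β] (m' : MeasurableSpace Ω)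
    [MeasurableSpace Ω] (P : Measure Ω) (f : ι → Ω → β) : Prop :=
  ∀ (s : Finset ι) (B : ι → Set β), (∀ i ∈ s, MeasurableSet (B i)) →
    P⟦⋂ i ∈ s, f i ⁻¹' B i | m'⟧ =ᵐ[P] ∏ i ∈ s, P⟦f i ⁻¹' B i | m'⟧

/-- For `J ⊆ ι ∖ I`, the coordinates `X_j`, `j ∈ J`, are mutually independent given
`X_I = (X_i)_{i ∈ I}`. -/
def CondIndepGiven {Ω ι β : Type*} [MeasurableSpace β] [MeasurableSpace Ω] (P : Measure Ω)
    (X : Ω → ι → β) (I : Set ι) (J : Set ↥Iᶜ) : Prop :=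
  MutuallyCondIndep (MeasurableSpace.comap (fun ω (i : I) => X ω i) MeasurableSpace.pi) P
    (fun (j : J) ω => X ω j.1)

/-! ### Realizations of matroids -/

/-- The vectors `v e` realize the matroid `M` over `F`. -/
def Realizes {α : Type*} (M : Matroid α) (F : Type*) [Field F] {W : Type*} [AddCommGroup W]
    [Module F W] (v : α → W) : Prop :=
  ∀ J ⊆ M.E, M.Indep J ↔ LinearIndepOn F v J

/-- `M` is representable over the field `F`. -/
def IsRepresentable {α : Type*} (M : Matroid α) (F : Type*) [Field F] : Prop :=
  ∃ (n : ℕ) (v : α → Fin n → F), Realizes M F v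

/-! ### Hermite normal form -/

section Hermite

variable {K : Type*} [Field K] [ValuativeRel K]

/-- `T ⊆ 𝒪[K]` is a set of representatives of the residue field containing `0`. -/
structure IsResidueSystem (T : Set 𝒪[K]) : Prop where
  zero_mem : 0 ∈ T
  bijOn : Set.BijOn (IsLocalRing.residue 𝒪[K]) T Set.univ

/-- `A` is in Hermite normal form with respect to the uniformizer `π` and the system of
representatives `T`: it is lower triangular, its diagonal entries are `π ^ n i`, and every entry
`A i j` with `j < i` is a Laurent polynomial in `π`, with coefficients in `T`, of degree less than
`n i` (the empty sum being `0`). -/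
def IsHermite {d : ℕ} (π : 𝒪[K]) (T : Set 𝒪[K]) (A : Matrix (Fin d) (Fin d) K) : Prop :=
  ∃ n : Fin d → ℤ,
    (∀ i j, i < j → A i j = 0) ∧
    (∀ i, A i i = (π : K) ^ n i) ∧
    (∀ i j, j < i → ∃ (s : Finset ℤ) (t : ℤ → 𝒪[K]),
      (∀ m ∈ s, m < n i ∧ t m ∈ T) ∧ A i j = ∑ m ∈ s, (t m : K) * (π : K) ^ m)

/-- The lattice `A 𝒪[K]^κ` generated by the columns of `A`. -/
def columnLattice {ι κ : Type*} [Fintype κ] (A : Matrix ι κ K) : Set (ι → K) :=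
  Set.range fun y : κ → 𝒪[K] => A *ᵥ fun k => (y k : K)

/-- `A` is the Hermite normal form of the set `L ⊆ K^d` after the coordinates have been listed in
the order `σ 0, σ 1, …`. -/
def IsHermiteFormOf {d : ℕ} (π : 𝒪[K]) (T : Set 𝒪[K]) (L : Set (Fin d → K))
    (σ : Equiv.Perm (Fin d)) (A : Matrix (Fin d) (Fin d) K) : Prop :=
  IsHermite π T A ∧ columnLattice A = (fun x => x ∘ σ) '' L

/-- The order `σ 0, σ 1, …` of the coordinates lists `I` first. -/
def ListsFirst {d : ℕ} (I : Set (Fin d)) (σ : Equiv.Perm (Fin d)) : Prop :=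
  ∀ i ∈ I, ∀ j ∉ I, σ.symm i < σ.symm j

/-- The lower right block of `A`, on the rows and columns at the positions of the coordinates
outside `I`, where `σ p` is the coordinate at position `p`. -/
def lowerBlock {d : ℕ} (I : Set (Fin d)) (σ : Equiv.Perm (Fin d))
    (A : Matrix (Fin d) (Fin d) K) : Matrix ↥Iᶜ ↥Iᶜ K :=
  A.submatrix (fun j => σ.symm j) (fun j => σ.symm j)

/-- `C` is obtained from `B` by scaling the rows so that they have norm `1`, the norm of a row
being the maximum of the absolute values of its entries. -/
def IsRowNormalization {ι κ : Type*} (B : Matrix ι κ K) (C : Matrix ι κ 𝒪[K]) : Prop :=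
  (∃ c : ι → K, ∀ i j, (C i j : K) = c i * B i j) ∧
    ∀ i, ∃ j, ValuativeRel.valuation K (C i j : K) = 1

/-- The rows of `C` reduced modulo the maximal ideal. -/
def reducedRow {ι κ : Type*} (C : Matrix ι κ 𝒪[K]) (i : ι) : κ → 𝓀[K] :=
  fun j => IsLocalRing.residue 𝒪[K] (C i j)

end Hermite

end LocalFieldGaussian

end

/-! Only the shears `(x, y) ↦ (x, a x + y)` are used from the Gaussian invariance. Disintegrating
over `x` shows that the law is invariant under translation by `a x` for almost every `x`
(`ae_mem_translationStabilizer`). Hence the support equals the translation stabilizer, a closed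
`𝒪[K]`-module `L` on which the law is uniform. It is bounded, since a ball of mass above 1/2 cannot
be disjoint from a translate of itself (`IsGaussianVector.exists_submodule`).

Given `X_I`, the law is uniform on a coset of the kernel of restriction to `I` in `L`
(`condExp_indicator_preimage_ae_eq`). Its coordinates in `J` are therefore independent exactly when
the fiber module `N` projects onto the product of its projections to the single `j ∈ J`
(`condIndepGiven_iff_projectsOntoProduct`).

This condition becomes linear algebra. Write `N` as a column lattice and scale the rows to norm 1:
each coordinate then projects onto `𝒪[K]`, so the condition says that the rows in `J` define a
surjection over `𝒪[K]`. A determinant argument lets this be checked over the residue field, where it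
means that the reduced rows are independent (`IsRowNormalization.projectsOntoProduct_iff`). So
conditional independence is a linear matroid over `𝓀[K]`. For a Hermite basis, triangularity makes
the lower block itself a generating matrix of `N` (`columnLattice_lowerBlock`). -/

noncomputable section

namespace LocalFieldGaussian

/-! ### Valuations of powers of a uniformizer -/

section Uniformizer

variable {K : Type*} [Field K] [ValuativeRel K] {π : 𝒪[K]}

local notation "v" => ValuativeRel.valuation K

theorem coe_uniformizer_ne_zero (hπ : Irreducible π) : (π : K) ≠ 0 := by
  simpa using hπ.ne_zero

theorem valuation_uniformizer_lt_one (hπ : Irreducible π) : v (π : K) < 1 :=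
  Valuation.Integer.not_isUnit_iff_valuation_lt_one.1 hπ.not_isUnit

theorem valuation_unit_eq_one (u : 𝒪[K]ˣ) : v (u : K) = 1 :=
  (Valuation.integer.integers v).isUnit_iff_valuation_eq_one.1 u.isUnit

/-- An integral scalar `a` with `a y = x`. -/
theorem exists_integer_mul_eq {x y : K} (hy : y ≠ 0) (h : v x ≤ v y) :
    ∃ a : 𝒪[K], (a : K) * y = x := by
  refine ⟨⟨x / y, ?_⟩, by field_simp⟩
  rw [Valuation.mem_integer_iff, map_div₀]
  exact div_le_one_of_le₀ h zero_le

theorem valuation_zpow_le_iff (hπ : Irreducible π) {m n : ℤ} :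
    v ((π : K) ^ m) ≤ v ((π : K) ^ n) ↔ n ≤ m := by
  rw [map_zpow₀, map_zpow₀]
  exact zpow_le_zpow_iff_right_of_lt_one₀
    (by simpa [zero_lt_iff] using coe_uniformizer_ne_zero hπ) (valuation_uniformizer_lt_one hπ)

variable [IsDiscreteValuationRing 𝒪[K]]

theorem exists_valuation_eq_zpow (hπ : Irreducible π) {x : K} (hx : x ≠ 0) :
    ∃ n : ℤ, v x = v ((π : K) ^ n) := by
  have key : ∀ y : 𝒪[K], y ≠ 0 → ∃ n : ℤ, v (y : K) = v ((π : K) ^ n) := by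
    intro y hy
    obtain ⟨n, u, rfl⟩ := IsDiscreteValuationRing.eq_unit_mul_pow_irreducible hy hπ
    exact ⟨n, by simp [valuation_unit_eq_one]⟩
  rcases le_total (v x) 1 with h | h
  · exact key ⟨x, h⟩ (by simpa [Subtype.ext_iff] using hx)
  · have h' : v x⁻¹ ≤ 1 := by
      rw [map_inv₀]; exact inv_le_one_of_one_le₀ h
    obtain ⟨n, hn⟩ := key ⟨x⁻¹, h'⟩ (by simpa [Subtype.ext_iff] using hx)
    refine ⟨-n, ?_⟩
    simp only [map_inv₀] at hn
    rw [zpow_neg, map_inv₀, ← hn, inv_inv]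

theorem exists_le_valuation_zpow (hπ : Irreducible π) (γ : ValuativeRel.ValueGroupWithZero K) :
    ∃ n : ℤ, γ ≤ v ((π : K) ^ n) := by
  obtain ⟨c, rfl⟩ := ValuativeRel.valuation_surjective γ
  rcases eq_or_ne c 0 with rfl | hc
  · exact ⟨0, by simp⟩
  · obtain ⟨n, hn⟩ := exists_valuation_eq_zpow hπ hc
    exact ⟨n, hn.le⟩

end Uniformizer

/-! ### Truncated `π`-adic expansions -/

section Expansion

variable {K : Type*} [Field K] [ValuativeRel K]

local notation "v" => ValuativeRel.valuation K

/-- `a` is a Laurent polynomial in `π` with coefficients in `T`, of degree less than `n`. -/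
def IsTruncatedExpansion (π : 𝒪[K]) (T : Set 𝒪[K]) (n : ℤ) (a : K) : Prop :=
  ∃ (s : Finset ℤ) (t : ℤ → 𝒪[K]),
    (∀ m ∈ s, m < n ∧ t m ∈ T) ∧ a = ∑ m ∈ s, (t m : K) * (π : K) ^ m

variable [IsDiscreteValuationRing 𝒪[K]] {π : 𝒪[K]} {T : Set 𝒪[K]}

theorem valuation_lt_one_iff_residue (x : 𝒪[K]) :
    v (x : K) < 1 ↔ IsLocalRing.residue 𝒪[K] x = 0 := by
  rw [IsLocalRing.residue_eq_zero_iff, IsLocalRing.mem_maximalIdeal, mem_nonunits_iff]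
  exact Valuation.Integer.not_isUnit_iff_valuation_lt_one.symm

theorem valuation_lt_one_le_uniformizer (hπ : Irreducible π) {x : K} (hx : v x < 1) :
    v x ≤ v (π : K) := by
  rcases eq_or_ne x 0 with rfl | h0
  · simp
  obtain ⟨n, hn⟩ := exists_valuation_eq_zpow hπ h0
  have h1 : v x ≤ v ((π : K) ^ (1 : ℤ)) := by
    rw [hn, valuation_zpow_le_iff hπ]
    by_contra! h
    have : v ((π : K) ^ (0 : ℤ)) ≤ v ((π : K) ^ n) := (valuation_zpow_le_iff hπ).2 (by omega)
    rw [← hn] at this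
    simp only [zpow_zero, map_one] at this
    exact absurd hx (not_lt.2 this)
  simpa using h1

/-- Peel off the lowest digit; the induction runs on the number of digits between the order of `a`
and `n`. -/
theorem exists_truncatedExpansion (hπ : Irreducible π) (hT : IsResidueSystem T) (n : ℤ) (a : K) :
    ∃ r, IsTruncatedExpansion π T n r ∧ v (a - r) ≤ v ((π : K) ^ n) := by
  have hπ0 := coe_uniformizer_ne_zero hπ
  have key : ∀ (k : ℕ) (a : K), v a ≤ v ((π : K) ^ (n - k)) →
      ∃ s : Finset ℤ, ∃ t : ℤ → 𝒪[K], (∀ m ∈ s, n - k ≤ m ∧ m < n ∧ t m ∈ T) ∧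
        v (a - ∑ m ∈ s, (t m : K) * (π : K) ^ m) ≤ v ((π : K) ^ n) := by
    intro k
    induction k with
    | zero =>
      intro a ha
      exact ⟨∅, 0, by simp, by simpa using ha⟩
    | succ k ih =>
      intro a ha
      obtain ⟨u, hu⟩ := exists_integer_mul_eq (zpow_ne_zero _ hπ0) ha
      obtain ⟨t₀, ht₀, hres⟩ := hT.bijOn.surjOn (mem_univ (IsLocalRing.residue 𝒪[K] u))
      have hlt : v ((u - t₀ : 𝒪[K]) : K) ≤ v (π : K) := by
        refine valuation_lt_one_le_uniformizer hπ ?_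
        rw [valuation_lt_one_iff_residue, map_sub, hres, sub_self]
      obtain ⟨s, t, hst, hv⟩ := ih (a - t₀ * (π : K) ^ (n - (k + 1 : ℕ))) (by
        have : a - t₀ * (π : K) ^ (n - (k + 1 : ℕ))
            = ((u - t₀ : 𝒪[K]) : K) * (π : K) ^ (n - (k + 1 : ℕ)) := by
          rw [← hu]; push_cast; ring
        rw [this, map_mul]
        have h2 : (π : K) ^ (n - k) = π * (π : K) ^ (n - (k + 1 : ℕ)) := by
          rw [← zpow_one_add₀ hπ0]; congr 1; push_cast; ring
        rw [h2, map_mul]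
        gcongr)
      have hns : n - (k + 1 : ℕ) ∉ s := fun h => by
        have := (hst _ h).1
        push_cast at this
        omega
      refine ⟨insert (n - (k + 1 : ℕ)) s, Function.update t (n - (k + 1 : ℕ)) t₀, ?_, ?_⟩
      · intro m hm
        rcases Finset.mem_insert.1 hm with rfl | hm
        · refine ⟨le_rfl, by push_cast; omega, by simpa using ht₀⟩
        · have hne : m ≠ n - (k + 1 : ℕ) := fun h => hns (h ▸ hm)
          rw [Function.update_of_ne hne]
          obtain ⟨h1, h2⟩ := hst m hm
          exact ⟨by push_cast; omega, h2⟩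
      · rw [Finset.sum_insert hns, Function.update_self]
        have : ∑ m ∈ s, ((Function.update t (n - (k + 1 : ℕ)) t₀ m : 𝒪[K]) : K) * (π : K) ^ m
            = ∑ m ∈ s, (t m : K) * (π : K) ^ m := by
          refine Finset.sum_congr rfl fun m hm => ?_
          rw [Function.update_of_ne (ne_of_mem_of_not_mem hm hns)]
        rw [this, ← sub_sub]
        exact hv
  obtain ⟨m, hm⟩ := exists_le_valuation_zpow hπ (v a)
  obtain ⟨s, t, hst, hv⟩ := key (n - m).toNat a (hm.trans ((valuation_zpow_le_iff hπ).2 (by omega)))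
  exact ⟨_, ⟨s, t, fun m hm => (hst m hm).2, rfl⟩, hv⟩

/-- At the lowest exponent `m₀ < n` where the digits differ, their difference is a unit, so the two
sums differ by something of valuation exactly that of `π ^ m₀`, too large for the hypothesis. -/
theorem IsTruncatedExpansion.eq_of_valuation_sub_le (hπ : Irreducible π) (hT : IsResidueSystem T)
    {n : ℤ} {a b : K} (ha : IsTruncatedExpansion π T n a) (hb : IsTruncatedExpansion π T n b)
    (h : v (a - b) ≤ v ((π : K) ^ n)) : a = b := by
  classical
  have hπ0 := coe_uniformizer_ne_zero hπ
  obtain ⟨s, t, hst, rfl⟩ := ha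
  obtain ⟨s', t', hst', rfl⟩ := hb
  -- Padding by the digit `0 ∈ T` lets both sums run over `s ∪ s'`.
  set e : ℤ → 𝒪[K] := fun m => if m ∈ s then t m else 0
  set e' : ℤ → 𝒪[K] := fun m => if m ∈ s' then t' m else 0
  have he : ∀ m, e m ∈ T := fun m => by
    by_cases hm : m ∈ s
    · simpa [e, hm] using (hst m hm).2
    · simpa [e, hm] using hT.zero_mem
  have he' : ∀ m, e' m ∈ T := fun m => by
    by_cases hm : m ∈ s'
    · simpa [e', hm] using (hst' m hm).2
    · simpa [e', hm] using hT.zero_mem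
  have hs : ∑ m ∈ s, (t m : K) * (π : K) ^ m = ∑ m ∈ s ∪ s', (e m : K) * (π : K) ^ m := by
    rw [← Finset.sum_subset (Finset.subset_union_left (s₂ := s'))
      (f := fun m => (e m : K) * (π : K) ^ m) (fun m _ hm => by simp [e, hm])]
    exact Finset.sum_congr rfl fun m hm => by simp [e, hm]
  have hs' : ∑ m ∈ s', (t' m : K) * (π : K) ^ m = ∑ m ∈ s ∪ s', (e' m : K) * (π : K) ^ m := by
    rw [← Finset.sum_subset (Finset.subset_union_right (s₁ := s))
      (f := fun m => (e' m : K) * (π : K) ^ m) (fun m _ hm => by simp [e', hm])]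
    exact Finset.sum_congr rfl fun m hm => by simp [e', hm]
  rw [hs, hs'] at h ⊢
  by_contra hne
  have hex : ((s ∪ s').filter fun m => e m ≠ e' m).Nonempty := by
    by_contra hemp
    rw [Finset.not_nonempty_iff_eq_empty, Finset.filter_eq_empty_iff] at hemp
    exact hne (Finset.sum_congr rfl fun m hm => by rw [not_not.1 (hemp hm)])
  obtain ⟨m₀, hm₀, hmin⟩ := Finset.exists_min_image _ id hex
  rw [Finset.mem_filter] at hm₀
  have hm₀n : m₀ < n := by
    rcases Finset.mem_union.1 hm₀.1 with h | h
    exacts [(hst _ h).1, (hst' _ h).1]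
  have hunit : v ((e m₀ - e' m₀ : 𝒪[K]) : K) = 1 := by
    refine le_antisymm (e m₀ - e' m₀).2 (not_lt.1 fun hlt => hm₀.2 ?_)
    rw [valuation_lt_one_iff_residue, map_sub, sub_eq_zero] at hlt
    exact hT.bijOn.injOn (he _) (he' _) hlt
  rw [← Finset.sum_sub_distrib, ← Finset.add_sum_erase _ _ hm₀.1] at h
  have hrest : v (∑ m ∈ (s ∪ s').erase m₀,
      ((e m : K) * (π : K) ^ m - (e' m : K) * (π : K) ^ m)) ≤ v ((π : K) ^ (m₀ + 1)) := by
    refine Valuation.map_sum_le _ fun m hm => ?_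
    obtain ⟨hmne, hm⟩ := Finset.mem_erase.1 hm
    by_cases heq : e m = e' m
    · simp [heq]
    have : (m₀ : ℤ) ≤ m := hmin m (Finset.mem_filter.2 ⟨hm, heq⟩)
    rw [← sub_mul, map_mul]
    calc v ((e m : K) - e' m) * v ((π : K) ^ m) ≤ 1 * v ((π : K) ^ m) := by
          gcongr; exact (e m - e' m).2
      _ ≤ _ := by rw [one_mul, valuation_zpow_le_iff hπ]; omega
  have hlast : v ((e m₀ : K) * (π : K) ^ m₀ - (e' m₀ : K) * (π : K) ^ m₀)
      ≤ v ((π : K) ^ (m₀ + 1)) := by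
    have hn : v ((π : K) ^ n) ≤ v ((π : K) ^ (m₀ + 1)) := (valuation_zpow_le_iff hπ).2 (by omega)
    have := (v).map_sub_le (h.trans hn) hrest
    rwa [add_sub_cancel_right] at this
  rw [← sub_mul, map_mul] at hlast
  have hu : v ((e m₀ : K) - e' m₀) = 1 := hunit
  rw [hu, one_mul, valuation_zpow_le_iff hπ] at hlast
  omega

end Expansion

/-! ### Forward substitution -/

section LowerTriangular

variable {K : Type*} [Field K]

theorem mulVec_apply_of_lowerTriangular {d : ℕ} {A : Matrix (Fin d) (Fin d) K}
    (htri : ∀ i j, i < j → A i j = 0) {y : Fin d → K} {i : Fin d} (h : ∀ j < i, y j = 0) :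
    (A *ᵥ y) i = A i i * y i := by
  rw [Matrix.mulVec, dotProduct, Finset.sum_eq_single i]
  · intro j _ hj
    rcases lt_or_gt_of_ne hj with h' | h'
    · simp [h j h']
    · simp [htri i j h']
  · simp

theorem eq_zero_of_mulVec_eq_zero_of_lowerTriangular {d : ℕ} {A : Matrix (Fin d) (Fin d) K}
    (htri : ∀ i j, i < j → A i j = 0) (hdiag : ∀ i, A i i ≠ 0) {y : Fin d → K} (j : Fin d)
    (h : ∀ i ≤ j, (A *ᵥ y) i = 0) : y j = 0 := by
  induction j using WellFoundedLT.induction with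
  | _ j ih =>
    have h1 := mulVec_apply_of_lowerTriangular htri
      fun i hi => ih i hi fun k hk => h k (hk.trans hi.le)
    rw [h j le_rfl] at h1
    exact (mul_eq_zero.1 h1.symm).resolve_left (hdiag j)

end LowerTriangular

/-! ### Existence and uniqueness of the Hermite normal form -/

section HermiteForm

variable {K : Type*} [Field K] [ValuativeRel K]

local notation "v" => ValuativeRel.valuation K

theorem mem_columnLattice {ι κ : Type*} [Fintype κ] {A : Matrix ι κ K} {x : ι → K} :
    x ∈ columnLattice A ↔ ∃ y : κ → 𝒪[K], (A *ᵥ fun k => (y k : K)) = x :=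
  Iff.rfl

theorem columnLattice_eq_span {ι κ : Type*} [Fintype κ] (A : Matrix ι κ K) :
    columnLattice A = (Submodule.span 𝒪[K] (Set.range fun j i => A i j) : Set (ι → K)) := by
  ext x
  rw [SetLike.mem_coe, Submodule.mem_span_range_iff_exists_fun, mem_columnLattice]
  refine exists_congr fun y => ?_
  have : (A *ᵥ fun k => (y k : K)) = ∑ k, y k • fun i => A i k := by
    ext i
    simp [Matrix.mulVec, dotProduct, Finset.sum_apply, Subring.smul_def, mul_comm]
  rw [this]

/-- A set of vectors with entries of bounded absolute value. -/
def HasBoundedEntries {ι : Type*} (L : Set (ι → K)) : Prop :=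
  ∃ γ, ∀ x ∈ L, ∀ i, v (x i) ≤ γ

/-- Forward substitution kills the coefficients before `i`, so the leading entry is an integral
multiple of `A i i`. Thus the lattice determines the sizes of the diagonal entries. -/
theorem valuation_le_of_mem_columnLattice {d : ℕ} {A : Matrix (Fin d) (Fin d) K}
    (htri : ∀ i j, i < j → A i j = 0) (hdiag : ∀ i, A i i ≠ 0) {x : Fin d → K}
    (hx : x ∈ columnLattice A) {i : Fin d} (h0 : ∀ j < i, x j = 0) : v (x i) ≤ v (A i i) := by
  obtain ⟨y, rfl⟩ := hx
  dsimp only at h0 ⊢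
  rw [mulVec_apply_of_lowerTriangular htri fun j hj =>
    eq_zero_of_mulVec_eq_zero_of_lowerTriangular htri hdiag j fun k hk => h0 k (hk.trans_lt hj),
    map_mul]
  exact mul_le_of_le_one_right zero_le (y i).2

theorem column_mem_columnLattice {ι κ : Type*} [Fintype κ] (A : Matrix ι κ K) (j : κ) :
    (fun i => A i j) ∈ columnLattice A := by
  rw [columnLattice_eq_span]
  exact Submodule.subset_span (mem_range_self j)

/-- A family of vectors of `L` in echelon form with maximal leading entries generates `L`. -/
theorem le_span_of_echelon {d : ℕ} {L : Submodule 𝒪[K] (Fin d → K)} {c : Fin d → Fin d → K}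
    (hc : ∀ j, c j ∈ L) (hc0 : ∀ j, ∀ i < j, c j i = 0) (hcne : ∀ j, c j j ≠ 0)
    (hmax : ∀ i, ∀ x ∈ L, (∀ j < i, x j = 0) → v (x i) ≤ v (c i i)) :
    L ≤ Submodule.span 𝒪[K] (Set.range c) := by
  -- `k` counts the trailing coordinates that may be nonzero; `hmax` makes the leading one removable
  -- by an integral multiple of `c i`.
  have key : ∀ k : ℕ, k ≤ d → ∀ x ∈ L, (∀ i : Fin d, i.val < d - k → x i = 0) →
      x ∈ Submodule.span 𝒪[K] (Set.range c) := by
    intro k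
    induction k with
    | zero =>
      intro _ x _ hx
      have : x = 0 := funext fun i => hx i (by simp)
      simp [this]
    | succ k ih =>
      intro hk x hxL hx
      set i : Fin d := ⟨d - (k + 1), by omega⟩
      have hxi : ∀ j < i, x j = 0 := fun j hj => hx j hj
      obtain ⟨a, ha⟩ := exists_integer_mul_eq (hcne i) (hmax i x hxL hxi)
      have h1 := ih (by omega) (x - a • c i) (L.sub_mem hxL (L.smul_mem a (hc i))) (by
        intro j hj
        rcases eq_or_ne j i with rfl | hji
        · simp [← ha, Subring.smul_def]
        · have : j < i := lt_of_le_of_ne (by rw [Fin.le_def]; simp only [i]; omega) hji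
          simp [hxi j this, hc0 i j this])
      have h2 := (Submodule.span 𝒪[K] (Set.range c)).smul_mem a (Submodule.subset_span (mem_range_self i))
      simpa using Submodule.add_mem _ h1 h2
  exact fun x hx => key d le_rfl x hx fun i hi => by simp at hi

variable [IsDiscreteValuationRing 𝒪[K]] {π : 𝒪[K]} {T : Set 𝒪[K]}

theorem exists_pow_smul_mem_of_span_eq_top {V : Type*} [AddCommGroup V] [Module K V]
    (hπ : Irreducible π) {L : Submodule 𝒪[K] V} (hL : Submodule.span K (L : Set V) = ⊤) (x : V) :
    ∃ n : ℕ, (π : K) ^ n • x ∈ L := by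
  have hmono : ∀ {m n : ℕ} {x : V}, m ≤ n → (π : K) ^ m • x ∈ L → (π : K) ^ n • x ∈ L := by
    intro m n x hmn h
    have := L.smul_mem (π ^ (n - m)) h
    rw [Subring.smul_def, smul_smul] at this
    push_cast at this
    rwa [← pow_add, Nat.sub_add_cancel hmn] at this
  have hx : x ∈ Submodule.span K (L : Set V) := hL ▸ Submodule.mem_top
  induction hx using Submodule.span_induction with
  | mem x hx => exact ⟨0, by simpa using hx⟩
  | zero => exact ⟨0, by simp⟩
  | add x y _ _ hx hy =>
    obtain ⟨m, hm⟩ := hx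
    obtain ⟨n, hn⟩ := hy
    refine ⟨max m n, ?_⟩
    rw [smul_add]
    exact L.add_mem (hmono (le_max_left _ _) hm) (hmono (le_max_right _ _) hn)
  | smul a x _ hx =>
    obtain ⟨m, hm⟩ := hx
    obtain ⟨k, hk⟩ := exists_le_valuation_zpow hπ (v a)
    obtain ⟨b, hb⟩ := exists_integer_mul_eq
      (zpow_ne_zero (-((-k).toNat : ℤ)) (coe_uniformizer_ne_zero hπ))
      (hk.trans ((valuation_zpow_le_iff hπ).2 (by omega)))
    refine ⟨m + (-k).toNat, ?_⟩
    have := L.smul_mem b hm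
    rw [Subring.smul_def, smul_smul] at this
    convert! this using 1
    rw [smul_smul, ← hb, zpow_neg, zpow_natCast, pow_add]
    congr 1
    have := pow_ne_zero (-k).toNat (coe_uniformizer_ne_zero hπ)
    field_simp

/-- The leading exponents of a bounded lattice of full rank. -/
theorem exists_leading_exponent {d : ℕ} (hπ : Irreducible π) {L : Submodule 𝒪[K] (Fin d → K)}
    (hb : HasBoundedEntries (L : Set (Fin d → K)))
    (hs : Submodule.span K (L : Set (Fin d → K)) = ⊤) (i : Fin d) :
    ∃ n : ℤ, (∃ y ∈ L, (∀ j < i, y j = 0) ∧ y i = (π : K) ^ n) ∧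
      ∀ x ∈ L, (∀ j < i, x j = 0) → v (x i) ≤ v ((π : K) ^ n) := by
  obtain ⟨γ, hγ⟩ := hb
  obtain ⟨b, hb⟩ := exists_le_valuation_zpow hπ γ
  obtain ⟨k, hk⟩ := exists_pow_smul_mem_of_span_eq_top hπ hs (Pi.single i 1)
  -- Boundedness of `L` bounds the exponents below and full rank supplies one; the least exponent is
  -- the largest leading entry.
  obtain ⟨n, hn, hmin⟩ := Int.exists_least_of_bdd
    (P := fun n => ∃ y ∈ L, (∀ j < i, y j = 0) ∧ y i = (π : K) ^ n)
    ⟨b, fun n ⟨y, hy, _, hyn⟩ => by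
      rw [← valuation_zpow_le_iff hπ, ← hyn]
      exact (hγ y hy i).trans hb⟩
    ⟨k, _, hk, fun j hj => by simp [hj.ne], by simp⟩
  refine ⟨n, hn, fun x hx hx0 => ?_⟩
  rcases eq_or_ne (x i) 0 with h0 | h0
  · simp [h0]
  obtain ⟨m, hm⟩ := exists_valuation_eq_zpow hπ h0
  obtain ⟨a, ha⟩ := exists_integer_mul_eq h0 hm.ge
  rw [hm, valuation_zpow_le_iff hπ]
  exact hmin m ⟨a • x, L.smul_mem a hx, fun j hj => by simp [hx0 j hj], ha⟩

/-- Each column starts as a vector of `L` with maximal leading entry and is reduced row by row from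
the top: the vector used at row `i` vanishes above `i`, so finished entries stay unchanged. -/
theorem exists_isHermite_columnLattice_eq {d : ℕ} (hπ : Irreducible π) (hT : IsResidueSystem T)
    {L : Submodule 𝒪[K] (Fin d → K)} (hb : HasBoundedEntries (L : Set (Fin d → K)))
    (hs : Submodule.span K (L : Set (Fin d → K)) = ⊤) :
    ∃ A : Matrix (Fin d) (Fin d) K, IsHermite π T A ∧ columnLattice A = (L : Set (Fin d → K)) := by
  choose n hn hmax using exists_leading_exponent hπ hb hs
  have hπ0 := coe_uniformizer_ne_zero hπ
  have key : ∀ (j : Fin d) (k : ℕ), ∃ x ∈ L, (∀ i < j, x i = 0) ∧ x j = (π : K) ^ n j ∧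
      ∀ i, j < i → i.val < k → IsTruncatedExpansion π T (n i) (x i) := by
    intro j k
    induction k with
    | zero =>
      obtain ⟨y, hy, h0, h1⟩ := hn j
      exact ⟨y, hy, h0, h1, by simp⟩
    | succ k ih =>
      obtain ⟨x, hxL, hx0, hxj, hx⟩ := ih
      by_cases hk : j.val < k ∧ k < d
      · set i : Fin d := ⟨k, hk.2⟩
        have hji : j < i := hk.1
        obtain ⟨y, hy, hy0, hyi⟩ := hn i
        obtain ⟨r, hr, hxr⟩ := exists_truncatedExpansion hπ hT (n i) (x i)
        obtain ⟨a, ha⟩ := exists_integer_mul_eq (zpow_ne_zero _ hπ0) hxr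
        refine ⟨x - a • y, L.sub_mem hxL (L.smul_mem a hy), ?_, ?_, ?_⟩
        · intro l hl
          simp [hx0 l hl, hy0 l (hl.trans hji)]
        · simp [hxj, hy0 j hji]
        · intro l hl hlk
          rcases eq_or_ne l i with rfl | hli
          · simpa [Subring.smul_def, hyi, ha] using hr
          · have hl' : l < i := lt_of_le_of_ne (by rw [Fin.le_def]; simp only [i]; omega) hli
            simpa [hy0 l hl'] using hx l hl hl'
      · refine ⟨x, hxL, hx0, hxj, fun i hi hik => hx i hi ?_⟩
        have := i.2
        have : j.val < i.val := hi
        omega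
  choose c hcL hc0 hcj hc using fun j => key j d
  refine ⟨.of fun i j => c j i, ⟨n, fun i j hij => hc0 j i hij, hcj, fun i j hij => hc j i hij i.2⟩, ?_⟩
  rw [columnLattice_eq_span]
  refine congrArg _ (le_antisymm ?_ ?_)
  · rw [Submodule.span_le]
    rintro _ ⟨j, rfl⟩
    exact hcL j
  · refine le_span_of_echelon (c := c) hcL hc0 (fun j => ?_) fun i x hx h0 => ?_
    · rw [hcj]; exact zpow_ne_zero _ hπ0
    · rw [hcj]; exact hmax i x hx h0

/-- The lattice fixes the diagonals. Going down the rows, the difference of two `j`-th columns is a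
lattice vector vanishing above row `i`, so its entry there lies in `π ^ n i 𝒪[K]`; uniqueness of
truncated expansions applies. -/
theorem IsHermite.eq_of_columnLattice_eq {d : ℕ} (hπ : Irreducible π) (hT : IsResidueSystem T)
    {A B : Matrix (Fin d) (Fin d) K} (hA : IsHermite π T A) (hB : IsHermite π T B)
    (h : columnLattice A = columnLattice B) : A = B := by
  obtain ⟨n, hA0, hAd, hAe⟩ := hA
  obtain ⟨m, hB0, hBd, hBe⟩ := hB
  have hπ0 := coe_uniformizer_ne_zero hπ
  have hAne : ∀ i, A i i ≠ 0 := fun i => hAd i ▸ zpow_ne_zero _ hπ0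
  have hBne : ∀ i, B i i ≠ 0 := fun i => hBd i ▸ zpow_ne_zero _ hπ0
  have hnm : n = m := by
    funext i
    have h1 := valuation_le_of_mem_columnLattice hB0 hBne
      (h ▸ column_mem_columnLattice A i) (fun j hj => hA0 j i hj)
    have h2 := valuation_le_of_mem_columnLattice hA0 hAne
      (h ▸ column_mem_columnLattice B i) (fun j hj => hB0 j i hj)
    rw [hAd, hBd, valuation_zpow_le_iff hπ] at h1 h2
    omega
  subst hnm
  ext i j
  induction i using WellFoundedLT.induction with
  | _ i ih =>
    rcases lt_trichotomy i j with hij | rfl | hji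
    · rw [hA0 i j hij, hB0 i j hij]
    · rw [hAd, hBd]
    · refine (show IsTruncatedExpansion π T (n i) (A i j) from hAe i j hji).eq_of_valuation_sub_le
        hπ hT (hBe i j hji) ?_
      have hmem : (fun k => A k j) - (fun k => B k j) ∈ columnLattice A := by
        have h1 := column_mem_columnLattice A j
        have h2 := h ▸ column_mem_columnLattice B j
        rw [columnLattice_eq_span] at h1 h2 ⊢
        exact Submodule.sub_mem _ h1 h2
      have := valuation_le_of_mem_columnLattice hA0 hAne hmem (i := i)
        fun k hk => by simp [ih k hk]
      rwa [hAd] at this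

end HermiteForm

/-! ### Matroids of vector families -/

section LinearMatroid

theorem exists_matroid_indep_iff_linearIndepOn {α F W : Type*} [Finite α] [Field F]
    [AddCommGroup W] [Module F W] (r : α → W) :
    ∃ M : Matroid α, M.E = univ ∧ ∀ J, M.Indep J ↔ LinearIndepOn F r J := by
  have aug : ∀ ⦃I J : Set α⦄, LinearIndepOn F r I → LinearIndepOn F r J → I.ncard < J.ncard →
      ∃ e ∈ J, e ∉ I ∧ LinearIndepOn F r (insert e I) := by
    intro I J hI hJ hlt
    by_contra! hcon
    have hle : Submodule.span F (r '' J) ≤ Submodule.span F (r '' I) := by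
      rw [Submodule.span_le]
      rintro _ ⟨e, he, rfl⟩
      by_cases heI : e ∈ I
      · exact Submodule.subset_span (mem_image_of_mem r heI)
      · by_contra hspan
        exact hcon e he heI ((linearIndepOn_insert heI).2 ⟨hI, hspan⟩)
    have hcard : ∀ S : Set α, LinearIndepOn F r S →
        Module.finrank F (Submodule.span F (r '' S)) = S.ncard := by
      intro S hS
      have := Fintype.ofFinite S
      rw [image_eq_range, finrank_span_eq_card hS, ← Nat.card_eq_fintype_card,
        Nat.card_coe_set_eq]
    have hfin : FiniteDimensional F (Submodule.span F (r '' I)) :=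
      FiniteDimensional.span_of_finite F (toFinite _)
    have := Submodule.finrank_mono hle
    rw [hcard I hI, hcard J hJ] at this
    omega
  exact ⟨(IndepMatroid.ofFinite (E := univ) finite_univ (fun J => LinearIndepOn F r J)
    (linearIndepOn_empty F r) (fun _ _ hJ hIJ => hJ.mono hIJ) aug
    fun _ _ => subset_univ _).matroid, rfl, fun J => Iff.rfl⟩

theorem linearIndepOn_ringEquiv_comp_iff {α κ F F' : Type*} [Field F] [Field F'] (e : F ≃+* F')
    (r : α → κ → F) (J : Set α) :
    LinearIndepOn F' (fun a k => e (r a k)) J ↔ LinearIndepOn F r J := by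
  constructor <;> intro h
  · have := LinearIndependent.map_of_injective_injective (R' := F) (M' := κ → F) h e
      (AddMonoidHom.compLeft e.symm.toRingHom.toAddMonoidHom κ) (by simp)
      (fun m hm => funext fun k => by simpa using congrFun hm k)
      (fun a m => funext fun k => by simp)
    have heq : (AddMonoidHom.compLeft e.symm.toRingHom.toAddMonoidHom κ) ∘
        (fun x : J => fun k => e (r x k)) = fun x : J => r x := by
      ext a k
      simp
    rwa [heq] at this
  · have := LinearIndependent.map_of_injective_injective (R' := F') (M' := κ → F') h e.symm
      (AddMonoidHom.compLeft e.toRingHom.toAddMonoidHom κ) (by simp)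
      (fun m hm => funext fun k => by simpa using congrFun hm k)
      (fun a m => funext fun k => by simp)
    exact this

theorem linearIndepOn_comp_equiv_iff {α κ κ' F : Type*} [Field F] (φ : κ' ≃ κ)
    (r : α → κ → F) (J : Set α) :
    LinearIndepOn F (fun a k => r a (φ k)) J ↔ LinearIndepOn F r J :=
  (LinearMap.funLeft F F φ).linearIndepOn_iff_of_injOn
    (LinearMap.funLeft_injective_of_surjective _ _ _ φ.surjective).injOn

end LinearMatroid

/-! ### Surjectivity over a local ring and over its residue field -/

section Surjectivity

theorem linearIndependent_rows_iff_mulVec_surjective {ι κ F : Type*} [Fintype ι] [Fintype κ]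
    [Field F] (A : Matrix ι κ F) :
    LinearIndependent F (fun i => A i) ↔ Function.Surjective A.mulVec := by
  classical
  constructor
  · intro h
    have h1 : A.rank = Fintype.card ι := LinearIndependent.rank_matrix h
    have h2 : LinearMap.range A.mulVecLin = ⊤ := by
      apply Submodule.eq_top_of_finrank_eq
      rw [Module.finrank_fintype_fun_eq_card]
      exact h1
    exact LinearMap.range_eq_top.1 h2
  · intro h
    obtain ⟨Q, hQ⟩ := Matrix.mulVec_surjective_iff_exists_right_inverse.1 h
    refine Matrix.vecMul_injective_iff.1 fun x y hxy => ?_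
    have := congrArg (fun z => z ᵥ* Q) hxy
    simpa [Matrix.vecMul_vecMul, hQ] using this

/-- A right inverse over the residue field lifts entrywise to some `Q`; the determinant of `A * Q`
is a unit because its residue is 1, so `Q` can be corrected. -/
theorem mulVec_surjective_iff_residue {ι κ R : Type*} [Fintype ι] [Fintype κ] [CommRing R]
    [IsLocalRing R] (A : Matrix ι κ R) :
    Function.Surjective A.mulVec ↔
      Function.Surjective (A.map (IsLocalRing.residue R)).mulVec := by
  classical
  rw [Matrix.mulVec_surjective_iff_exists_right_inverse,
    Matrix.mulVec_surjective_iff_exists_right_inverse]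
  constructor
  · rintro ⟨Q, hQ⟩
    exact ⟨Q.map (IsLocalRing.residue R), by rw [← Matrix.map_mul, hQ]; simp⟩
  · rintro ⟨Q', hQ'⟩
    choose f hf using IsLocalRing.residue_surjective (R := R)
    set Q : Matrix κ ι R := Q'.map f
    have hQ : Q.map (IsLocalRing.residue R) = Q' := by
      ext i j; simp [Q, hf]
    have hdet : IsUnit (A * Q).det := by
      rw [← IsLocalRing.residue_ne_zero_iff_isUnit, RingHom.map_det, RingHom.mapMatrix_apply,
        Matrix.map_mul, hQ, hQ', Matrix.det_one]
      exact one_ne_zero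
    exact ⟨Q * (A * Q)⁻¹, by rw [← Matrix.mul_assoc, Matrix.mul_nonsing_inv _ hdet]⟩

end Surjectivity

/-! ### Product projections and independence of reduced rows -/

section Product

/-- The projection of `N` to the coordinates in `J` is the product of the projections of `N` to
the coordinates `j ∈ J`. -/
def ProjectsOntoProduct {ι β : Type*} (N : Set (ι → β)) (J : Set ι) : Prop :=
  ∀ w : ι → β, (∀ j ∈ J, ∃ x ∈ N, x j = w j) → ∃ x ∈ N, ∀ j ∈ J, x j = w j

variable {K : Type*} [Field K] [ValuativeRel K] {ι κ : Type*} [Fintype κ]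

local notation "v" => ValuativeRel.valuation K

theorem exists_isRowNormalization {B : Matrix ι κ K} (hB : ∀ i, ∃ j, B i j ≠ 0) :
    ∃ C : Matrix ι κ 𝒪[K], IsRowNormalization B C := by
  have : ∀ i, ∃ k, B i k ≠ 0 ∧ ∀ j, v (B i j) ≤ v (B i k) := by
    intro i
    obtain ⟨j₀, hj₀⟩ := hB i
    obtain ⟨k, -, hk⟩ := Finset.exists_max_image Finset.univ (fun j => v (B i j))
      ⟨j₀, Finset.mem_univ _⟩
    refine ⟨k, fun h => ?_, fun j => hk j (Finset.mem_univ _)⟩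
    have := hk j₀ (Finset.mem_univ _)
    simp [h, hj₀] at this
  choose k hk0 hk using this
  refine ⟨.of fun i j => ⟨(B i (k i))⁻¹ * B i j, ?_⟩,
    ⟨fun i => (B i (k i))⁻¹, fun i j => rfl⟩, fun i => ⟨k i, ?_⟩⟩
  · rw [Valuation.mem_integer_iff, map_mul, map_inv₀, ← div_eq_inv_mul]
    exact div_le_one_of_le₀ (hk i j) zero_le
  · simp [hk0 i]

/-- A row of norm 1 contains a unit, so each coordinate of `C` projects onto all of `𝒪[K]` and the
product of the projections is `𝒪[K]^J`. Scaling rows by nonzero constants does not affect the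
product property. -/
theorem IsRowNormalization.projectsOntoProduct_iff_mulVec_surjective {B : Matrix ι κ K}
    {C : Matrix ι κ 𝒪[K]} (hC : IsRowNormalization B C) (J : Set ι) :
    ProjectsOntoProduct (columnLattice B) J ↔
      Function.Surjective (C.submatrix ((↑) : J → ι) id).mulVec := by
  classical
  obtain ⟨⟨c, hc⟩, hunit⟩ := hC
  have hc0 : ∀ i, c i ≠ 0 := fun i h => by
    obtain ⟨j, hj⟩ := hunit i
    rw [hc, h, zero_mul, map_zero] at hj
    exact zero_ne_one hj
  have hmul : ∀ (y : κ → 𝒪[K]) i, ((C *ᵥ y) i : K) = c i * (B *ᵥ fun k => (y k : K)) i := by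
    intro y i
    simp only [Matrix.mulVec, dotProduct, Finset.mul_sum]
    push_cast
    exact Finset.sum_congr rfl fun j _ => by rw [hc]; ring
  constructor
  · intro h u
    have hrow : ∀ j, ∀ a : 𝒪[K], ∃ y : κ → 𝒪[K], (C *ᵥ y) j = a := by
      intro j a
      obtain ⟨k, hk⟩ := hunit j
      have hu : IsUnit (C j k) :=
        (Valuation.integer.integers v).isUnit_iff_valuation_eq_one.2 hk
      obtain ⟨b, hb⟩ := hu
      refine ⟨Pi.single k (↑b⁻¹ * a), ?_⟩
      simp [← hb]
    set w : ι → K := fun i => if hi : i ∈ J then (c i)⁻¹ * u ⟨i, hi⟩ else 0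
    obtain ⟨x, ⟨y, rfl⟩, hx⟩ := h w (fun j hj => by
      obtain ⟨y, hy⟩ := hrow j (u ⟨j, hj⟩)
      refine ⟨_, ⟨y, rfl⟩, ?_⟩
      have := hmul y j
      rw [hy] at this
      simp only [w, hj, dif_pos, this]
      field_simp [hc0 j])
    refine ⟨y, funext fun j => Subtype.ext ?_⟩
    have h1 : ((C.submatrix ((↑) : J → ι) id) *ᵥ y) j = (C *ᵥ y) j := rfl
    have h2 := hx j j.2
    simp only [w, j.2, dif_pos] at h2
    rw [h1, hmul, h2]
    field_simp [hc0 j]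
  · intro h w hw
    choose! x hx hxw using hw
    choose! y hy using hx
    obtain ⟨z, hz⟩ := h fun j => (C *ᵥ y j) j
    refine ⟨_, ⟨z, rfl⟩, fun j hj => ?_⟩
    have h1 : (C *ᵥ z) j = (C *ᵥ y j) j := congrFun hz ⟨j, hj⟩
    have h2 := congrArg ((↑) : 𝒪[K] → K) h1
    rw [hmul, hmul] at h2
    rw [← hxw j hj, ← hy j hj]
    exact mul_left_cancel₀ (hc0 j) h2

/-- A zero row cannot be normalized. Giving it a private column makes it nonzero and lets its
coordinate vary freely, which leaves the product property intact. -/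
theorem projectsOntoProduct_fromCols_diagonal_iff [Fintype ι] [DecidableEq ι] (B : Matrix ι κ K)
    (e : ι → K) (he : ∀ i, e i = 0 ∨ ∀ j, B i j = 0) (J : Set ι) :
    ProjectsOntoProduct (columnLattice (B.fromCols (Matrix.diagonal e))) J ↔
      ProjectsOntoProduct (columnLattice B) J := by
  have hmul : ∀ y : κ ⊕ ι → 𝒪[K], (B.fromCols (Matrix.diagonal e) *ᵥ fun k => (y k : K))
      = fun i => (B *ᵥ fun k => (y (.inl k) : K)) i + e i * y (.inr i) := by
    intro y
    rw [Matrix.fromCols_mulVec]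
    ext i
    simp [Matrix.mulVec_diagonal, Function.comp_def]
  have hzero : ∀ i, (∀ j, B i j = 0) → ∀ y : κ → K, (B *ᵥ y) i = 0 := fun i hi y => by
    simp [Matrix.mulVec, dotProduct, hi]
  constructor
  · intro h w hw
    obtain ⟨x, ⟨y, rfl⟩, hy⟩ := h w fun j hj => by
      obtain ⟨_, ⟨y, rfl⟩, hy⟩ := hw j hj
      exact ⟨_, ⟨Sum.elim y 0, rfl⟩, by simp only [hmul]; simpa using hy⟩
    refine ⟨_, ⟨fun k => y (.inl k), rfl⟩, fun j hj => ?_⟩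
    have h1 := hy j hj
    simp only [hmul] at h1
    rcases he j with h0 | h0
    · simpa [h0] using h1
    · obtain ⟨_, ⟨y', rfl⟩, hy'⟩ := hw j hj
      rw [← hy']
      simp only [hzero j h0]
  · intro h w hw
    choose! x hx hxw using hw
    choose! y hy using hx
    have hyw : ∀ j ∈ J, (B *ᵥ fun k => (y j (.inl k) : K)) j + e j * y j (.inr j) = w j := by
      intro j hj
      rw [← hxw j hj, ← hy j hj]
      simp only [hmul]
    obtain ⟨_, ⟨z, rfl⟩, hz⟩ := h (fun j => (B *ᵥ fun k => (y j (.inl k) : K)) j)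
      fun j hj => ⟨_, ⟨fun k => y j (.inl k), rfl⟩, rfl⟩
    refine ⟨_, ⟨Sum.elim z fun i => y i (.inr i), rfl⟩, fun j hj => ?_⟩
    rw [← hyw j hj]
    simp only [hmul, Sum.elim_inl, Sum.elim_inr]
    rw [← hz j hj]

variable [Finite ι]

theorem IsRowNormalization.projectsOntoProduct_iff {B : Matrix ι κ K} {C : Matrix ι κ 𝒪[K]}
    (hC : IsRowNormalization B C) (J : Set ι) :
    ProjectsOntoProduct (columnLattice B) J ↔ LinearIndepOn 𝓀[K] (reducedRow C) J := by
  have := Fintype.ofFinite J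
  rw [hC.projectsOntoProduct_iff_mulVec_surjective, mulVec_surjective_iff_residue,
    ← linearIndependent_rows_iff_mulVec_surjective]
  rfl

variable [IsDiscreteValuationRing 𝒪[K]]

/-- A bounded module lies in `π ^ n 𝒪[K]^ι`, which is Noetherian. -/
theorem fg_of_hasBoundedEntries {N : Submodule 𝒪[K] (ι → K)}
    (hN : HasBoundedEntries (N : Set (ι → K))) : N.FG := by
  obtain ⟨γ, hγ⟩ := hN
  obtain ⟨π, hπ⟩ := IsDiscreteValuationRing.exists_irreducible 𝒪[K]
  obtain ⟨n, hn⟩ := exists_le_valuation_zpow hπ γ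
  have hπ0 := zpow_ne_zero n (coe_uniformizer_ne_zero hπ)
  set f : (ι → 𝒪[K]) →ₗ[𝒪[K]] (ι → K) :=
    { toFun := fun y i => (y i : K) * (π : K) ^ n
      map_add' := fun y z => by ext i; simp [add_mul]
      map_smul' := fun a y => by ext i; simp [Subring.smul_def, mul_assoc] }
  have hle : N ≤ LinearMap.range f := by
    intro x hx
    choose y hy using fun i => exists_integer_mul_eq hπ0 ((hγ x hx i).trans hn)
    exact ⟨y, funext hy⟩
  rw [← Submodule.map_comap_eq_of_le hle]
  exact (IsNoetherian.noetherian _).map f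

theorem exists_columnLattice_eq {N : Submodule 𝒪[K] (ι → K)}
    (hN : HasBoundedEntries (N : Set (ι → K))) :
    ∃ (n : ℕ) (B : Matrix ι (Fin n) K), columnLattice B = (N : Set (ι → K)) := by
  obtain ⟨n, s, hs⟩ := Submodule.fg_iff_exists_fin_generating_family.1 (fg_of_hasBoundedEntries hN)
  exact ⟨n, .of fun i j => s j i, by rw [columnLattice_eq_span, ← hs]; rfl⟩

/-- Over the residue field, the sets of coordinates onto which a bounded module projects as a
product are the independent sets of a family of vectors. -/
theorem exists_linearIndepOn_iff_projectsOntoProduct {N : Submodule 𝒪[K] (ι → K)}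
    (hN : HasBoundedEntries (N : Set (ι → K))) :
    ∃ (n : ℕ) (r : ι → Fin n → 𝓀[K]), ∀ J : Set ι,
      LinearIndepOn 𝓀[K] r J ↔ ProjectsOntoProduct (N : Set (ι → K)) J := by
  classical
  have := Fintype.ofFinite ι
  obtain ⟨n, B, hB⟩ := exists_columnLattice_eq hN
  -- A constant coordinate is independent of everything, so it must not become a loop: its row
  -- receives a column of its own.
  set e : ι → K := fun i => if ∀ j, B i j = 0 then 1 else 0
  set B' := B.fromCols (Matrix.diagonal e)
  obtain ⟨C, hC⟩ := exists_isRowNormalization (B := B') fun i => by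
    by_cases h : ∀ j, B i j = 0
    · exact ⟨.inr i, by simp [B', e, h]⟩
    · push Not at h
      obtain ⟨j, hj⟩ := h
      exact ⟨.inl j, by simpa [B'] using hj⟩
  let φ := Fintype.equivFin (Fin n ⊕ ι)
  refine ⟨_, fun i k => reducedRow C i (φ.symm k), fun J => ?_⟩
  rw [← hB, ← projectsOntoProduct_fromCols_diagonal_iff B e
    (fun i => by by_cases h : ∀ j, B i j = 0 <;> simp [e, h]) J, hC.projectsOntoProduct_iff]
  exact linearIndepOn_comp_equiv_iff φ.symm (reducedRow C) J

end Product

/-! ### The fiber module and the lower right block -/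

section LowerBlock

variable {K : Type*} [Field K] [ValuativeRel K] {d : ℕ}

/-- The coordinates outside `I` of the vectors of `L` whose coordinates in `I` vanish. -/
def fiberModule {ι : Type*} (I : Set ι) (L : Submodule 𝒪[K] (ι → K)) :
    Submodule 𝒪[K] (↥Iᶜ → K) :=
  (L ⊓ ⨅ i ∈ I, LinearMap.ker (LinearMap.proj (R := 𝒪[K]) (φ := fun _ : ι => K) i)).map
    (LinearMap.funLeft 𝒪[K] K ((↑) : ↥Iᶜ → ι))

theorem mem_fiberModule {ι : Type*} {I : Set ι} {L : Submodule 𝒪[K] (ι → K)} {z : ↥Iᶜ → K} :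
    z ∈ fiberModule I L ↔ ∃ x ∈ L, (∀ i ∈ I, x i = 0) ∧ ∀ j : ↥Iᶜ, x j = z j := by
  simp only [fiberModule, Submodule.mem_map, Submodule.mem_inf, Submodule.mem_iInf,
    LinearMap.mem_ker, LinearMap.proj_apply, and_assoc]
  exact exists_congr fun x => and_congr_right fun _ => and_congr_right fun _ =>
    ⟨fun h j => congrFun h j, fun h => funext h⟩

theorem HasBoundedEntries.fiberModule {ι : Type*} {I : Set ι} {L : Submodule 𝒪[K] (ι → K)}
    (hL : HasBoundedEntries (L : Set (ι → K))) :
    HasBoundedEntries (fiberModule I L : Set (↥Iᶜ → K)) := by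
  obtain ⟨γ, hγ⟩ := hL
  refine ⟨γ, fun z hz j => ?_⟩
  obtain ⟨x, hx, -, hxz⟩ := mem_fiberModule.1 hz
  exact hxz j ▸ hγ x hx j

/-- Since `I` is listed first, `A y` vanishes on `I` exactly when `y` does, by forward substitution;
the remaining coefficients act through the lower block. -/
theorem columnLattice_lowerBlock {I : Set (Fin d)} [Fintype ↥Iᶜ] {σ : Equiv.Perm (Fin d)}
    (hσ : ListsFirst I σ) {L : Submodule 𝒪[K] (Fin d → K)} {A : Matrix (Fin d) (Fin d) K}
    (htri : ∀ i j, i < j → A i j = 0) (hdiag : ∀ i, A i i ≠ 0)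
    (hA : columnLattice A = (fun x => x ∘ σ) '' (L : Set (Fin d → K))) :
    columnLattice (lowerBlock I σ A) = (fiberModule I L : Set (↥Iᶜ → K)) := by
  classical
  have hmul : ∀ y : Fin d → K, (∀ i ∈ I, y (σ.symm i) = 0) → ∀ j : ↥Iᶜ,
      (A *ᵥ y) (σ.symm j) = (lowerBlock I σ A *ᵥ fun k => y (σ.symm k)) j := by
    intro y hy j
    simp only [Matrix.mulVec, dotProduct, lowerBlock, Matrix.submatrix_apply]
    rw [← Equiv.sum_comp σ.symm, ← Finset.sum_subtype (Finset.univ.filter (· ∈ Iᶜ)) (by simp)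
      (fun i => A (σ.symm j) (σ.symm i) * y (σ.symm i)), Finset.sum_filter]
    refine Finset.sum_congr rfl fun i _ => ?_
    split_ifs with h
    · rfl
    · simp [hy i (by simpa using h)]
  ext z
  rw [SetLike.mem_coe, mem_fiberModule, mem_columnLattice]
  constructor
  · rintro ⟨y, rfl⟩
    set y' : Fin d → 𝒪[K] := fun p => if h : σ p ∈ Iᶜ then y ⟨σ p, h⟩ else 0
    have hy'0 : ∀ i ∈ I, y' (σ.symm i) = 0 := fun i hi => by simp [y', hi]
    obtain ⟨x, hx, hxA⟩ := hA.subset (⟨y', rfl⟩ : (A *ᵥ fun k => (y' k : K)) ∈ columnLattice A)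
    have hx' : ∀ i, x i = (A *ᵥ fun k => (y' k : K)) (σ.symm i) := fun i => by
      rw [← hxA]; simp
    refine ⟨x, hx, fun i hi => ?_, fun j => ?_⟩
    · rw [hx', Matrix.mulVec, dotProduct]
      refine Finset.sum_eq_zero fun p _ => ?_
      by_cases hp : σ p ∈ I
      · have := hy'0 _ hp
        rw [Equiv.symm_apply_apply] at this
        simp [this]
      · have := hσ i hi (σ p) hp
        rw [Equiv.symm_apply_apply] at this
        simp [htri _ _ this]
    · rw [hx', hmul _ (fun i hi => by simp [hy'0 i hi])]
      have : (fun k : ↥Iᶜ => (y' (σ.symm k) : K)) = fun k => (y k : K) := by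
        ext k
        have hk : (k : Fin d) ∉ I := k.2
        simp [y', hk]
      rw [this]
  · rintro ⟨x, hx, hx0, hxz⟩
    obtain ⟨y, hy⟩ := mem_columnLattice.1 (hA ▸ mem_image_of_mem (fun x => x ∘ σ) hx)
    have hy0 : ∀ i ∈ I, (y (σ.symm i) : K) = 0 := by
      intro i hi
      refine eq_zero_of_mulVec_eq_zero_of_lowerTriangular htri hdiag (y := fun k => (y k : K))
        (σ.symm i) fun p hp => ?_
      rw [hy]
      refine hx0 _ ?_
      by_contra hpI
      have := hσ i hi _ hpI
      rw [Equiv.symm_apply_apply] at this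
      exact absurd hp (not_le.2 this)
    refine ⟨fun k => y (σ.symm k), funext fun j => ?_⟩
    rw [← hxz, ← hmul (fun k => (y k : K)) hy0, hy]
    simp

end LowerBlock

/-! ### Local fields are Polish -/

section Topology

variable (K : Type*) [Field K] [ValuativeRel K] [TopologicalSpace K]
  [IsNonarchimedeanLocalField K]

open scoped Valued in
theorem polishSpace_of_isNonarchimedeanLocalField : PolishSpace K := by
  let := IsTopologicalAddGroup.rightUniformSpace K
  have := isUniformAddGroup_of_addCommGroup (G := K)
  let : (Valued.v (R := K)).RankOne :=
  { hom' := ValuativeRel.IsRankLeOne.nonempty.some.emb (R := K).comp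
      MonoidWithZeroHom.ValueGroup₀.embedding
    strictMono' := ValuativeRel.IsRankLeOne.nonempty.some.strictMono.comp
        MonoidWithZeroHom.ValueGroup₀.embedding_strictMono }
  have : ProperSpace K := .of_nontriviallyNormedField_of_weaklyLocallyCompactSpace K
  infer_instance

end Topology

/-! ### Uniform measures on subgroups -/

section Uniform

/-- The probability measure `ρ` is concentrated on `G` and invariant under translation by `G`. -/
structure IsUniformOn {V : Type*} [AddGroup V] [MeasurableSpace V] (ρ : Measure V)
    (G : AddSubgroup V) : Prop where
  ae_mem : ∀ᵐ x ∂ρ, x ∈ G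
  map_add : ∀ g ∈ G, ρ.map (· + g) = ρ

variable {V : Type*} [AddCommGroup V] [MeasurableSpace V]

/-- The law of the sum of independent variables with laws `ρ₁` and `ρ₂` equals each of them:
condition on one summand and use the invariance of the other. -/
theorem IsUniformOn.eq [MeasurableAdd₂ V] {ρ₁ ρ₂ : Measure V} [IsProbabilityMeasure ρ₁]
    [IsProbabilityMeasure ρ₂] {G : AddSubgroup V} (h₁ : IsUniformOn ρ₁ G)
    (h₂ : IsUniformOn ρ₂ G) : ρ₁ = ρ₂ := by
  ext E hE
  have hm : MeasurableSet {p : V × V | p.1 + p.2 ∈ E} := (measurable_fst.add measurable_snd) hE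
  have e₁ : (ρ₁.prod ρ₂) {p : V × V | p.1 + p.2 ∈ E} = ρ₂ E := by
    rw [Measure.prod_apply hm]
    have : ∀ᵐ x ∂ρ₁, ρ₂ (Prod.mk x ⁻¹' {p : V × V | p.1 + p.2 ∈ E}) = ρ₂ E := by
      filter_upwards [h₁.ae_mem] with x hx
      conv_rhs => rw [← h₂.map_add x hx, Measure.map_apply (measurable_add_const x) hE]
      congr 1
      ext y
      simp [add_comm]
    rw [lintegral_congr_ae this]
    simp
  have e₂ : (ρ₁.prod ρ₂) {p : V × V | p.1 + p.2 ∈ E} = ρ₁ E := by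
    rw [Measure.prod_apply_symm hm]
    have : ∀ᵐ y ∂ρ₂, ρ₁ ((fun x => (x, y)) ⁻¹' {p : V × V | p.1 + p.2 ∈ E}) = ρ₁ E := by
      filter_upwards [h₂.ae_mem] with y hy
      conv_rhs => rw [← h₁.map_add y hy, Measure.map_apply (measurable_add_const y) hE]
      rfl
    rw [lintegral_congr_ae this]
    simp
  rw [← e₁, e₂]

variable [TopologicalSpace V] [IsTopologicalAddGroup V] [BorelSpace V] [T2Space V]

theorem exists_isUniformOn (G : AddSubgroup V) (hG : IsCompact (G : Set V)) :
    ∃ ν : Measure V, IsProbabilityMeasure ν ∧ IsUniformOn ν G ∧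
      ∀ U, IsOpen U → (U ∩ G).Nonempty → 0 < ν U := by
  have : CompactSpace G := isCompact_iff_compactSpace.1 hG
  set η : Measure G := Measure.addHaarMeasure ⊤
  have hη : η univ = 1 := by
    have := Measure.addHaarMeasure_self (K₀ := (⊤ : TopologicalSpace.PositiveCompacts G))
    simpa using this
  have hval : Measurable ((↑) : G → V) := measurable_subtype_coe
  refine ⟨η.map (↑), ⟨by rw [Measure.map_apply hval MeasurableSet.univ, preimage_univ, hη]⟩,
    ⟨?_, ?_⟩, ?_⟩
  · exact (ae_map_iff (p := (· ∈ G)) hval.aemeasurable hG.isClosed.measurableSet).2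
      (Filter.Eventually.of_forall fun x => x.2)
  · intro g hg
    have hadd : Measurable fun x : V => x + g := by fun_prop
    have hadd' : Measurable fun x : G => x + ⟨g, hg⟩ := by fun_prop
    rw [Measure.map_map hadd hval]
    have : (fun x : V => x + g) ∘ ((↑) : G → V) = (↑) ∘ fun x : G => x + ⟨g, hg⟩ := rfl
    rw [this, ← Measure.map_map hval hadd', map_add_right_eq_self]
  · rintro U hU ⟨x, hxU, hxG⟩
    rw [Measure.map_apply hval hU.measurableSet]
    exact (hU.preimage continuous_subtype_val).measure_pos _ ⟨⟨x, hxG⟩, hxU⟩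

end Uniform

/-! ### The translation stabilizer of a measure -/

section Stabilizer

variable {V : Type*} [AddCommGroup V] [MeasurableSpace V]

/-- The translations that preserve `μ`. -/
def translationStabilizer [MeasurableAdd V] (μ : Measure V) : AddSubgroup V where
  carrier := {y | μ.map (· + y) = μ}
  zero_mem' := by simp
  add_mem' {a b} ha hb := by
    have hm : ∀ c : V, Measurable (· + c) := fun c => measurable_add_const c
    have : (fun x : V => x + (a + b)) = (· + b) ∘ (· + a) := by ext x; simp [add_assoc]
    rw [mem_ofPred_eq] at ha hb ⊢
    rw [this, ← Measure.map_map (hm b) (hm a), ha, hb]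
  neg_mem' {a} ha := by
    have hm : ∀ c : V, Measurable (· + c) := fun c => measurable_add_const c
    rw [mem_ofPred_eq] at ha ⊢
    conv_lhs => rw [← ha]
    rw [Measure.map_map (hm _) (hm _)]
    have : (fun x : V => x + -a) ∘ (· + a) = id := by ext x; simp
    rw [this, Measure.map_id]

variable [TopologicalSpace V] [IsTopologicalAddGroup V] [PolishSpace V] [BorelSpace V]

/-- Invariance is tested on bounded continuous functions, whose integrals depend continuously on the
translation by dominated convergence. -/
theorem isClosed_translationStabilizer (μ : Measure V) [IsFiniteMeasure μ] :
    IsClosed (translationStabilizer μ : Set V) := by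
  have hm : ∀ c : V, Measurable (· + c) := fun c => measurable_add_const c
  have : (translationStabilizer μ : Set V) =
      ⋂ f : BoundedContinuousFunction V ℝ, {y | ∫ x, f (x + y) ∂μ = ∫ x, f x ∂μ} := by
    ext y
    rw [mem_iInter]
    constructor
    · intro (h : μ.map (· + y) = μ) f
      rw [mem_ofPred_eq]
      conv_rhs => rw [← h]
      rw [integral_map (hm y).aemeasurable f.continuous.aestronglyMeasurable]
    · intro h
      let := TopologicalSpace.upgradeIsCompletelyMetrizable V
      refine ext_of_forall_integral_eq_of_IsFiniteMeasure fun f => ?_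
      rw [integral_map (hm y).aemeasurable f.continuous.aestronglyMeasurable]
      exact h f
  rw [this]
  refine isClosed_iInter fun f => isClosed_eq ?_ continuous_const
  refine continuous_of_dominated (bound := fun _ => ‖f‖) ?_ ?_ (integrable_const _) ?_
  · exact fun y => (f.continuous.comp (continuous_add_const y)).aestronglyMeasurable
  · exact fun y => Filter.Eventually.of_forall fun x => f.norm_coe_le_norm _
  · exact Filter.Eventually.of_forall fun x => f.continuous.comp (continuous_const_add x)

/-- If the law of a pair of independent copies is invariant under `(x, y) ↦ (x, a x + y)`, then
the common law is invariant under translation by `a x` for almost all `x`. -/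
theorem ae_mem_translationStabilizer {μ : Measure V} [IsProbabilityMeasure μ] {φ : V → V}
    (hφ : Measurable φ)
    (h : (μ.prod μ).map (fun p => (p.1, φ p.1 + p.2)) = μ.prod μ) :
    ∀ᵐ x ∂μ, φ x ∈ translationStabilizer μ := by
  have hmeas : Measurable fun p : V × V => φ p.1 + p.2 := by fun_prop
  -- The conditional law of the second coordinate after the shear. Before the shear it is the
  -- constant `μ`, and disintegrations agree almost everywhere.
  let κ : Kernel V V :=
    ⟨fun x => μ.map fun y => φ x + y, by
      refine Measure.measurable_of_measurable_coe _ fun E hE => ?_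
      have : ∀ x, (μ.map fun y => φ x + y) E = μ (Prod.mk x ⁻¹' {p | φ p.1 + p.2 ∈ E}) := by
        intro x
        rw [Measure.map_apply (measurable_const_add _) hE]
        rfl
      simp_rw [this]
      exact measurable_measure_prodMk_left (hmeas hE)⟩
  have hκ : ∀ x, κ x = μ.map fun y => φ x + y := fun x => rfl
  have : IsMarkovKernel κ := ⟨fun x => by
    rw [hκ]; exact Measure.isProbabilityMeasure_map (measurable_const_add _).aemeasurable⟩
  have hcomp : μ ⊗ₘ κ = μ ⊗ₘ Kernel.const V μ := by
    rw [Measure.compProd_const, ← h]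
    ext S hS
    have hm : Measurable fun p : V × V => (p.1, φ p.1 + p.2) := measurable_fst.prodMk hmeas
    rw [Measure.compProd_apply hS, Measure.map_apply hm hS, Measure.prod_apply (hm hS)]
    refine lintegral_congr fun x => ?_
    rw [hκ, Measure.map_apply (measurable_const_add _) (measurable_prodMk_left hS)]
    rfl
  filter_upwards [Kernel.ae_eq_of_compProd_eq hcomp] with x hx
  rw [hκ, Kernel.const_apply] at hx
  change μ.map (· + φ x) = μ
  simpa only [add_comm] using hx

/-- A stabilizing `y` is in the support because translation by `y - x` preserves `μ` and carries a
support point `x` to `y`. -/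
theorem support_eq_translationStabilizer {μ : Measure V} [IsProbabilityMeasure μ]
    (h : ∀ᵐ x ∂μ, x ∈ translationStabilizer μ) :
    μ.support = translationStabilizer μ := by
  have hsub : μ.support ⊆ translationStabilizer μ :=
    Measure.support_subset_of_isClosed (isClosed_translationStabilizer μ) h
  refine hsub.antisymm fun y hy => ?_
  obtain ⟨x, hx⟩ := Measure.nonempty_support (IsProbabilityMeasure.ne_zero μ)
  have hyx : μ.map (· + (y - x)) = μ := (translationStabilizer μ).sub_mem hy (hsub hx)
  rw [Measure.mem_support_iff_forall] at hx ⊢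
  intro U hU
  have hc : Continuous fun z : V => z + (y - x) := continuous_add_const _
  obtain ⟨W, hWU, hW, hyW⟩ := mem_nhds_iff.1 hU
  refine lt_of_lt_of_le ?_ (measure_mono hWU)
  rw [← hyx, Measure.map_apply hc.measurable hW.measurableSet]
  exact hx _ ((hW.preimage hc).mem_nhds (by simpa using hyW))

end Stabilizer

/-! ### The law of a Gaussian vector is uniform on a bounded module -/

section Support

theorem IsGaussianVector.map_shear {K : Type*} [Field K] [ValuativeRel K] [MeasurableSpace K]
    {ι Ω : Type*} [MeasurableSpace Ω] {X : Ω → ι → K} {P : Measure Ω} (hX : IsGaussianVector X P)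
    (a : 𝒪[K]) :
    ((P.map X).prod (P.map X)).map (fun p => (p.1, a • p.1 + p.2))
      = (P.map X).prod (P.map X) := by
  have hdet : IsUnit (!![1, 0; a, 1] : Matrix (Fin 2) (Fin 2) 𝒪[K]).det := by
    simp [Matrix.det_fin_two]
  have := hX.map_eq (Matrix.GeneralLinearGroup.mk'' _ hdet)
  convert this using 2
  funext p
  simp [pairAction, Matrix.GeneralLinearGroup.mk'', Matrix.nonsingInvUnit, Subring.smul_def]

variable {K : Type*} [Field K] [ValuativeRel K] [TopologicalSpace K]
  [IsNonarchimedeanLocalField K]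

local notation "v" => ValuativeRel.valuation K

theorem isClosed_valuation_le [T2Space K] (γ : ValuativeRel.ValueGroupWithZero K) :
    IsClosed {x : K | v x ≤ γ} :=
  (IsNonarchimedeanLocalField.isCompact_closedBall K γ).isClosed

theorem HasBoundedEntries.isCompact {ι : Type*} {L : Set (ι → K)} [T2Space K]
    (hb : HasBoundedEntries L) (hL : IsClosed L) : IsCompact L := by
  obtain ⟨γ, hγ⟩ := hb
  exact (isCompact_univ_pi fun _ : ι =>
    IsNonarchimedeanLocalField.isCompact_closedBall K γ).of_isClosed_subset hL
    fun x hx i _ => hγ x hx i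

theorem exists_valuation_ball_lt_measure [MeasurableSpace K] {ι : Type*} [Finite ι] (μ : Measure (ι → K))
    [IsProbabilityMeasure μ] :
    ∃ γ, 1 / 2 < μ {x | ∀ i, v (x i) ≤ γ} := by
  obtain ⟨π, hπ⟩ := IsDiscreteValuationRing.exists_irreducible 𝒪[K]
  set S : ℕ → Set (ι → K) := fun n => {x | ∀ i, v (x i) ≤ v ((π : K) ^ (-(n : ℤ)))}
  have hmono : Monotone S := fun m n hmn x hx i =>
    (hx i).trans ((valuation_zpow_le_iff hπ).2 (by omega))
  have hunion : ⋃ n, S n = univ := by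
    refine eq_univ_of_forall fun x => mem_iUnion.2 ?_
    choose m hm using fun i => exists_le_valuation_zpow hπ (v (x i))
    have := Fintype.ofFinite ι
    refine ⟨Finset.univ.sup fun i => (-(m i)).toNat, fun i => (hm i).trans
      ((valuation_zpow_le_iff hπ).2 ?_)⟩
    have : (-(m i)).toNat ≤ Finset.univ.sup fun i => (-(m i)).toNat :=
      Finset.le_sup (f := fun i => (-(m i)).toNat) (Finset.mem_univ i)
    omega
  have hlim := tendsto_measure_iUnion_atTop (μ := μ) hmono
  rw [hunion, measure_univ] at hlim
  obtain ⟨n, hn⟩ := (hlim.eventually (lt_mem_nhds (by simp : (1 / 2 : ENNReal) < 1))).exists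
  exact ⟨_, hn⟩

variable [MeasurableSpace K] [BorelSpace K] {ι Ω : Type*} [MeasurableSpace Ω]
  {X : Ω → ι → K} {P : Measure Ω}

/-- If `y` has an entry larger than the radius of a ball of mass above 1/2, the ball and its
preimage under translation by `y` are disjoint by the ultrametric inequality, yet have equal mass.
-/
theorem hasBoundedEntries_translationStabilizer [PolishSpace K] [Finite ι] (μ : Measure (ι → K))
    [IsProbabilityMeasure μ] :
    HasBoundedEntries (translationStabilizer μ : Set (ι → K)) := by
  obtain ⟨γ, hγ⟩ := exists_valuation_ball_lt_measure μ
  refine ⟨γ, fun y hy => ?_⟩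
  by_contra! hcon
  obtain ⟨i, hi⟩ := hcon
  set S : Set (ι → K) := {x | ∀ i, v (x i) ≤ γ}
  have hS : MeasurableSet S := by
    have : IsClosed S := by
      simp only [S, ofPred_forall]
      exact isClosed_iInter fun i =>
        (isClosed_valuation_le γ).preimage (continuous_apply (A := fun _ : ι => K) i)
    exact this.measurableSet
  have hadd : Measurable fun x : ι → K => x + y := measurable_add_const y
  have hy' : μ.map (· + y) = μ := hy
  have h1 : μ ((fun x => x + y) ⁻¹' S) = μ S := by
    conv_rhs => rw [← hy', Measure.map_apply hadd hS]
  have hdisj : Disjoint S ((fun x => x + y) ⁻¹' S) := by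
    rw [Set.disjoint_left]
    intro x hx hxy
    have hxy' : v (x i + y i) ≤ γ := hxy i
    have := (v).map_sub_le hxy' (hx i)
    rw [add_sub_cancel_left] at this
    exact absurd hi (not_lt.2 this)
  have h2 := measure_union (μ := μ) hdisj (hadd hS)
  rw [h1] at h2
  have h3 : 1 < μ S + μ S := by
    have := ENNReal.add_lt_add hγ hγ
    rwa [ENNReal.add_halves] at this
  exact absurd (h2 ▸ h3) (not_lt.2 prob_le_one)

/-- The support of the law of a Gaussian vector is a bounded `𝒪[K]`-module, on which the law is
uniform. -/
theorem IsGaussianVector.exists_submodule [PolishSpace K] [Finite ι] [IsProbabilityMeasure P]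
    (hX : IsGaussianVector X P) :
    ∃ L : Submodule 𝒪[K] (ι → K), (L : Set (ι → K)) = latticeOf X P ∧
      IsUniformOn (P.map X) L.toAddSubgroup ∧ HasBoundedEntries (L : Set (ι → K)) ∧
      IsClosed (L : Set (ι → K)) := by
  set μ := P.map X
  have : IsProbabilityMeasure μ := Measure.isProbabilityMeasure_map hX.measurable.aemeasurable
  have hsmul : ∀ a : 𝒪[K], Measurable fun x : ι → K => a • x := fun a =>
    (continuous_const_smul a).measurable
  have hae : ∀ a : 𝒪[K], ∀ᵐ x ∂μ, a • x ∈ translationStabilizer μ := fun a =>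
    ae_mem_translationStabilizer (hsmul a) (hX.map_shear a)
  have hae1 : ∀ᵐ x ∂μ, x ∈ translationStabilizer μ := by simpa using hae 1
  have hsupp := support_eq_translationStabilizer hae1
  let L : Submodule 𝒪[K] (ι → K) :=
    { translationStabilizer μ with
      smul_mem' := fun a x hx => by
        -- The `x` with `a • x` in the stabilizer form a closed set of full measure, so it contains
        -- the support, that is, the stabilizer.
        have hcl : IsClosed ((fun x => a • x) ⁻¹' (translationStabilizer μ : Set (ι → K))) :=
          (isClosed_translationStabilizer μ).preimage (continuous_const_smul a)
        exact Measure.support_subset_of_isClosed hcl (hae a) (hsupp ▸ hx) }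
  exact ⟨L, hsupp.symm, ⟨hae1, fun g hg => hg⟩, hasBoundedEntries_translationStabilizer μ,
    isClosed_translationStabilizer μ⟩

end Support

/-! ### Conditional laws of uniform vectors -/

section Conditional

/-- A function constant on fibers factors through the image; the factor is measurable because `L` is
standard Borel. Off the measurable image it is set to 0. -/
theorem exists_measurable_eq_of_forall_eq {V W : Type*} [TopologicalSpace V] [PolishSpace V]
    [MeasurableSpace V] [BorelSpace V] [MeasurableSpace W] [MeasurableSpace.CountablySeparated W]
    {f : V → W} (hf : Measurable f) {L : Set V} (hL : MeasurableSet L) (hfL : MeasurableSet (f '' L))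
    {h : V → ℝ} (hh : Measurable h) (hfib : ∀ x ∈ L, ∀ y ∈ L, f x = f y → h x = h y) :
    ∃ g : W → ℝ, Measurable g ∧ ∀ x ∈ L, g (f x) = h x := by
  classical
  have := hL.standardBorel
  set F : L → W := fun x => f x
  have hF : Measurable F := hf.comp measurable_subtype_coe
  have hrange : range F = f '' L := by
    rw [image_eq_range]
  set g : W → ℝ := fun w => if hw : ∃ x ∈ L, f x = w then h hw.choose else 0
  have hg : ∀ x ∈ L, g (f x) = h x := by
    intro x hx
    have hw : ∃ y ∈ L, f y = f x := ⟨x, hx, rfl⟩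
    simp only [g, hw, dif_pos]
    exact hfib _ hw.choose_spec.1 _ hx hw.choose_spec.2
  refine ⟨g, ?_, hg⟩
  have h1 : Measurable (g ∘ F) := by
    have : g ∘ F = fun x : L => h x := funext fun x => hg x x.2
    rw [this]
    exact hh.comp measurable_subtype_coe
  have : MeasurableSpace.CountablySeparated (range F) :=
    MeasurableSpace.CountablySeparated.subtype_iff.2
      ((MeasurableSpace.countablySeparated_def.1 ‹_›).mono (fun _ h => h) (subset_univ _))
  rw [hF.measurable_comp_iff_restrict] at h1
  refine measurable_of_restrict_of_restrict_compl (hrange ▸ hfL) h1 ?_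
  have : (range F)ᶜ.domRestrict g = fun _ => 0 := by
    ext w
    have hw : ¬ ∃ x ∈ L, f x = (w : W) := by
      rintro ⟨x, hx, hxw⟩
      exact w.2 ⟨⟨x, hx⟩, hxw⟩
    simp [domRestrict, g, hw]
  rw [this]
  exact measurable_const

variable {V W : Type*} [AddCommGroup V] [TopologicalSpace V] [IsTopologicalAddGroup V]
  [PolishSpace V] [MeasurableSpace V] [BorelSpace V] [AddCommGroup W] [MeasurableSpace W]

/-- Adding `z` from `L ⊓ f.ker` preserves both `μ` and the value of `f`; integrate over `z` and
exchange the integrals. -/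
theorem lintegral_translate_inter_eq {f : V →+ W} (hf : Measurable f) {L : AddSubgroup V}
    {μ ν : Measure V} [IsProbabilityMeasure μ] [IsProbabilityMeasure ν] (hμ : IsUniformOn μ L)
    (hν : IsUniformOn ν (L ⊓ f.ker)) {E : Set V} (hE : MeasurableSet E) {F : Set W}
    (hF : MeasurableSet F) :
    ∫⁻ x in f ⁻¹' F, ν ((x + ·) ⁻¹' E) ∂μ = μ (E ∩ f ⁻¹' F) := by
  have hfF := hf hF
  have hS : MeasurableSet {p : V × V | f p.1 ∈ F ∧ p.1 + p.2 ∈ E} :=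
    ((hf.comp measurable_fst) hF).inter ((measurable_fst.add measurable_snd) hE)
  have e₁ : (μ.prod ν) {p : V × V | f p.1 ∈ F ∧ p.1 + p.2 ∈ E}
      = ∫⁻ x in f ⁻¹' F, ν ((x + ·) ⁻¹' E) ∂μ := by
    rw [Measure.prod_apply hS, ← lintegral_indicator hfF]
    refine lintegral_congr fun x => ?_
    by_cases hx : f x ∈ F
    · rw [indicator_of_mem (by exact hx)]
      congr 1
      ext z
      simp [hx]
    · rw [indicator_of_notMem (by exact hx)]
      simp [hx]
  have e₂ : (μ.prod ν) {p : V × V | f p.1 ∈ F ∧ p.1 + p.2 ∈ E} = μ (E ∩ f ⁻¹' F) := by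
    rw [Measure.prod_apply_symm hS]
    have : ∀ᵐ z ∂ν, μ ((fun x => (x, z)) ⁻¹' {p : V × V | f p.1 ∈ F ∧ p.1 + p.2 ∈ E})
        = μ (E ∩ f ⁻¹' F) := by
      filter_upwards [hν.ae_mem] with z hz
      rw [AddSubgroup.mem_inf, AddMonoidHom.mem_ker] at hz
      conv_rhs =>
        rw [← hμ.map_add z hz.1, Measure.map_apply (measurable_add_const z) (hE.inter hfF)]
      congr 1
      ext x
      simp [hz.2, and_comm]
    rw [lintegral_congr_ae this]
    simp
  rw [← e₁, e₂]

/-- The conditional law of a uniform vector `X` given `f X` is uniform on a coset of `ker f`. -/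
theorem condExp_indicator_preimage_ae_eq [MeasurableSpace.CountablySeparated W] {f : V →+ W}
    (hf : Measurable f) {L : AddSubgroup V} (hL : IsClosed (L : Set V))
    (hfL : MeasurableSet (f '' L)) {Ω : Type*} [mΩ : MeasurableSpace Ω] {P : Measure Ω}
    [IsProbabilityMeasure P] {X : Ω → V} (hX : Measurable X) {ν : Measure V}
    [IsProbabilityMeasure ν] (hμ : IsUniformOn (P.map X) L) (hν : IsUniformOn ν (L ⊓ f.ker))
    {E : Set V} (hE : MeasurableSet E) :
    P⟦X ⁻¹' E | MeasurableSpace.comap (fun ω => f (X ω)) inferInstance⟧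
      =ᵐ[P] fun ω => ν.real ((X ω + ·) ⁻¹' E) := by
  have hfX : Measurable fun ω => f (X ω) := hf.comp hX
  have hm : MeasurableSpace.comap (fun ω => f (X ω)) inferInstance ≤ mΩ := hfX.comap_le
  have : IsProbabilityMeasure (P.map X) := Measure.isProbabilityMeasure_map hX.aemeasurable
  set h : V → ℝ := fun x => ν.real ((x + ·) ⁻¹' E)
  have hh' : Measurable fun x => ν ((x + ·) ⁻¹' E) :=
    measurable_measure_prodMk_left ((measurable_fst.add measurable_snd) hE)
  have hh : Measurable h := hh'.ennreal_toReal
  -- The candidate `h` depends only on `f x` for `x ∈ L`, since `ν` absorbs differences in the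
  -- kernel. This gives measurability with respect to the conditioning.
  have hfib : ∀ x ∈ L, ∀ y ∈ L, f x = f y → h x = h y := by
    intro x hx y hy hxy
    have hmem : x - y ∈ L ⊓ f.ker := by
      rw [AddSubgroup.mem_inf, AddMonoidHom.mem_ker, map_sub, hxy, sub_self]
      exact ⟨L.sub_mem hx hy, rfl⟩
    simp only [h, Measure.real]
    conv_rhs =>
      rw [← hν.map_add _ hmem, Measure.map_apply (measurable_add_const _)
        ((measurable_const_add y) hE)]
    congr 2
    ext z
    simp only [mem_preimage]
    rw [show y + (z + (x - y)) = x + z by abel]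
  obtain ⟨g, hg, hgh⟩ := exists_measurable_eq_of_forall_eq hf hL.measurableSet hfL hh hfib
  have hae : ∀ᵐ ω ∂P, X ω ∈ L := ae_of_ae_map hX.aemeasurable hμ.ae_mem
  refine (ae_eq_condExp_of_forall_setIntegral_eq hm
    ((integrable_const (1 : ℝ)).indicator (hX hE)) ?_ ?_ ?_).symm
  · intro s _ _
    refine Integrable.integrableOn ⟨(hh.comp hX).aestronglyMeasurable, ?_⟩
    exact HasFiniteIntegral.of_bounded (C := 1) (Filter.Eventually.of_forall fun ω => by
      rw [Real.norm_of_nonneg measureReal_nonneg]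
      exact measureReal_le_one)
  · rintro s ⟨F, hF, rfl⟩ _
    rw [setIntegral_indicator (hX hE), setIntegral_const, smul_eq_mul, mul_one]
    simp only [Measure.real]
    rw [integral_toReal (f := fun ω => ν ((X ω + ·) ⁻¹' E)) (hh'.comp hX).aemeasurable
      (Filter.Eventually.of_forall fun ω => measure_lt_top _ _)]
    congr 1
    have h1 := setLIntegral_map (μ := P) (hf hF) hh' hX
    rw [lintegral_translate_inter_eq hf hμ hν hE hF,
      Measure.map_apply hX (hE.inter (hf hF))] at h1
    rw [inter_comm]
    exact h1.symm
  · refine ⟨fun ω => g (f (X ω)), ?_, ?_⟩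
    · exact (hg.comp (comap_measurable _)).stronglyMeasurable
    · filter_upwards [hae] with ω hω
      exact (hgh _ hω).symm

end Conditional

/-! ### Independence under a uniform measure -/

section Coordinates

variable {K : Type*} [Field K] [ValuativeRel K] [TopologicalSpace K]
  [IsNonarchimedeanLocalField K]

local notation "v" => ValuativeRel.valuation K

theorem exists_ball_subset {U : Set K} (hU : IsOpen U) {w : K} (hw : w ∈ U) :
    ∃ γ, γ ≠ 0 ∧ ∀ y, v (y - w) < γ → y ∈ U := by
  have h0 : (fun x => x + w) ⁻¹' U ∈ nhds (0 : K) :=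
    (hU.preimage (continuous_add_const w)).mem_nhds (by simpa using hw)
  obtain ⟨γ, hγ, h⟩ := (IsValuativeTopology.hasBasis_nhds_zero' K).mem_iff.1 h0
  exact ⟨γ, hγ, fun y hy => by simpa using h (a := y - w) hy⟩

theorem isOpen_valuation_sub_lt (γ : ValuativeRel.ValueGroupWithZero K) (w : K) :
    IsOpen {y : K | v (y - w) < γ} := by
  have h : IsOpen {y : K | v y < γ} := by
    rw [isOpen_iff_mem_nhds]
    intro y hy
    rw [mem_ofPred_eq] at hy
    have h0 : {x : K | v x < γ} ∈ nhds (0 : K) :=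
      (IsValuativeTopology.hasBasis_nhds_zero' K).mem_of_mem (ne_zero_of_lt hy)
    have h1 : (fun x => x - y) ⁻¹' {x : K | v x < γ} ∈ nhds y :=
      (continuous_sub_right y).continuousAt.preimage_mem_nhds (by simpa using h0)
    refine Filter.mem_of_superset h1 fun x hx => ?_
    have := (v).map_add_lt hx hy
    simpa using this
  exact h.preimage (continuous_sub_right w)

variable [PolishSpace K] [MeasurableSpace K] [BorelSpace K]

/-- The joint law and the product of the marginals are both uniform on the product of the
projections of `G`, hence equal. -/
theorem IsUniformOn.iIndepFun_coordinates {V κ : Type*} [Fintype κ] [AddCommGroup V]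
    [TopologicalSpace V] [MeasurableSpace V] [BorelSpace V] [MeasurableAdd V] {G : AddSubgroup V}
    (hG : IsCompact (G : Set V)) {ν : Measure V} [IsProbabilityMeasure ν] (hν : IsUniformOn ν G)
    {f : κ → V →+ K} (hf : ∀ j, Continuous (f j))
    (hsurj : ∀ w : κ → K, (∀ j, ∃ z ∈ G, f j z = w j) → ∃ z ∈ G, ∀ j, f j z = w j) :
    iIndepFun (fun j z => f j z) ν := by
  have hfm : ∀ j, Measurable (f j) := fun j => (hf j).measurable
  have hpm : Measurable fun z j => f j z := measurable_pi_lambda _ hfm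
  rw [iIndepFun_iff_map_fun_eq_pi_map fun j => (hfm j).aemeasurable]
  have : ∀ j, IsProbabilityMeasure (ν.map (f j)) := fun j =>
    Measure.isProbabilityMeasure_map (hfm j).aemeasurable
  have : IsProbabilityMeasure (ν.map fun z j => f j z) :=
    Measure.isProbabilityMeasure_map hpm.aemeasurable
  have hcl : ∀ j, IsClosed (G.map (f j) : Set K) := fun j => by
    rw [AddSubgroup.coe_map]
    exact (hG.image (hf j)).isClosed
  let H : AddSubgroup (κ → K) := AddSubgroup.pi univ fun j => G.map (f j)
  have hH : ∀ w, w ∈ H ↔ ∀ j, w j ∈ G.map (f j) := fun w => by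
    simp [H, AddSubgroup.mem_pi]
  refine IsUniformOn.eq (G := H) ⟨?_, ?_⟩ ⟨?_, ?_⟩
  · have hHm : MeasurableSet {w | w ∈ H} := by
      have : {w | w ∈ H} = ⋂ j, (fun w : κ → K => w j) ⁻¹' (G.map (f j)) := by
        ext w; simp [hH]
      rw [this]
      exact MeasurableSet.iInter fun j => measurable_pi_apply j (hcl j).measurableSet
    rw [ae_map_iff hpm.aemeasurable hHm]
    filter_upwards [hν.ae_mem] with z hz
    exact (hH _).2 fun j => ⟨z, hz, rfl⟩
  · intro w hw
    obtain ⟨z, hz, hzw⟩ := hsurj w ((hH w).1 hw)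
    have hm : Measurable fun x : κ → K => x + w := measurable_add_const w
    have hm' : Measurable fun x : V => x + z := measurable_add_const z
    rw [Measure.map_map hm hpm]
    conv_rhs => rw [← hν.map_add z hz, Measure.map_map hpm hm']
    congr 1
    ext x j
    simp [hzw]
  · have : ∀ j, ∀ᵐ w ∂Measure.pi fun j => ν.map (f j), w j ∈ G.map (f j) := by
      intro j
      refine Measure.tendsto_eval_ae_ae.eventually (p := (· ∈ G.map (f j))) ?_
      refine (ae_map_iff (p := (· ∈ G.map (f j))) (hfm j).aemeasurable (hcl j).measurableSet).2 ?_
      filter_upwards [hν.ae_mem] with z hz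
      exact ⟨z, hz, rfl⟩
    filter_upwards [ae_all_iff.2 this] with w hw
    exact (hH w).2 hw
  · intro w hw
    have hmap : ∀ j, (ν.map (f j)).map (· + w j) = ν.map (f j) := by
      intro j
      obtain ⟨z, hz, hzw⟩ := (hH w).1 hw j
      have hm : Measurable fun x : K => x + w j := measurable_add_const _
      have hm' : Measurable fun x : V => x + z := measurable_add_const z
      rw [Measure.map_map hm (hfm j)]
      conv_rhs => rw [← hν.map_add z hz, Measure.map_map (hfm j) hm']
      congr 1
      ext x
      simp [hzw]
    have : ∀ j, SigmaFinite ((ν.map (f j)).map (· + w j)) := fun j => by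
      rw [hmap]; infer_instance
    have h1 := Measure.pi_map_pi (μ := fun j => ν.map (f j)) (f := fun j x => x + w j)
      fun j => (measurable_add_const (w j)).aemeasurable
    simp only [hmap] at h1
    exact h1

end Coordinates

/-! ### Conditional independence as a product projection -/

section CondIndep

variable {K : Type*} [Field K]

/-- The restriction of vectors to the coordinates in `I`. -/
def restrictCoords {ι : Type*} (I : Set ι) : (ι → K) →+ (I → K) where
  toFun x i := x i
  map_zero' := rfl
  map_add' _ _ := rfl

theorem mem_ker_restrictCoords {ι : Type*} {I : Set ι} {x : ι → K} :
    x ∈ (restrictCoords I : (ι → K) →+ (I → K)).ker ↔ ∀ i ∈ I, x i = 0 := by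
  rw [AddMonoidHom.mem_ker, funext_iff, Subtype.forall]
  rfl

variable [ValuativeRel K]

theorem projectsOntoProduct_fiberModule_iff {ι : Type*} {I : Set ι}
    {L : Submodule 𝒪[K] (ι → K)} {J : Set ↥Iᶜ} :
    ProjectsOntoProduct (fiberModule I L : Set (↥Iᶜ → K)) J ↔
      ∀ w : J → K, (∀ j, ∃ z ∈ L.toAddSubgroup ⊓ (restrictCoords I).ker, z j.1 = w j) →
        ∃ z ∈ L.toAddSubgroup ⊓ (restrictCoords I).ker, ∀ j : J, z j.1 = w j := by
  classical
  simp only [AddSubgroup.mem_inf, Submodule.mem_toAddSubgroup, mem_ker_restrictCoords]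
  constructor
  · intro h w hw
    obtain ⟨x, hx, hxw⟩ := h (fun j => if hj : j ∈ J then w ⟨j, hj⟩ else 0) fun j hj => by
      obtain ⟨z, hz, hzw⟩ := hw ⟨j, hj⟩
      exact ⟨fun k => z k, mem_fiberModule.2 ⟨z, hz.1, hz.2, fun _ => rfl⟩, by simpa [hj] using hzw⟩
    obtain ⟨z, hz, hz0, hzx⟩ := mem_fiberModule.1 hx
    exact ⟨z, ⟨hz, hz0⟩, fun j => by rw [hzx, hxw j j.2]; simp⟩
  · intro h w hw
    obtain ⟨z, hz, hzw⟩ := h (fun j => w j) fun j => by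
      obtain ⟨x, hx, hxw⟩ := hw j j.2
      obtain ⟨z, hz, hz0, hzx⟩ := mem_fiberModule.1 hx
      exact ⟨z, ⟨hz, hz0⟩, by rw [hzx, hxw]⟩
    exact ⟨fun k => z k, mem_fiberModule.2 ⟨z, hz.1, hz.2, fun _ => rfl⟩,
      fun j hj => hzw ⟨j, hj⟩⟩

local notation "v" => ValuativeRel.valuation K

variable [TopologicalSpace K] [IsNonarchimedeanLocalField K] [MeasurableSpace K] [BorelSpace K]
  {ι Ω : Type*} [Finite ι] [MeasurableSpace Ω]
  {X : Ω → ι → K} {P : Measure Ω} [IsProbabilityMeasure P]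

theorem condIndepGiven_iff_ae [PolishSpace K] (hX : Measurable X) {L : AddSubgroup (ι → K)}
    (hL : IsCompact (L : Set (ι → K))) (hμ : IsUniformOn (P.map X) L) (I : Set ι)
    {ν : Measure (ι → K)} [IsProbabilityMeasure ν]
    (hν : IsUniformOn ν (L ⊓ (restrictCoords I).ker)) (J : Set ↥Iᶜ) :
    CondIndepGiven P X I J ↔ ∀ (s : Finset J) (B : J → Set K), (∀ i ∈ s, MeasurableSet (B i)) →
      ∀ᵐ ω ∂P, ν.real {z | ∀ i ∈ s, X ω i.1 + z i.1 ∈ B i}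
        = ∏ i ∈ s, ν.real {z | X ω i.1 + z i.1 ∈ B i} := by
  have hf : Continuous (restrictCoords I : (ι → K) →+ (I → K)) :=
    continuous_pi fun i => continuous_apply i.1
  have hcond := fun {E : Set (ι → K)} (hE : MeasurableSet E) =>
    condExp_indicator_preimage_ae_eq hf.measurable hL.isClosed
      (hL.image hf).isClosed.measurableSet hX hμ hν hE
  refine forall_congr' fun s => forall_congr' fun B => forall_congr' fun hB => ?_
  have hEi : ∀ i ∈ s, MeasurableSet {x : ι → K | x i.1 ∈ B i} := fun i hi =>
    measurable_pi_apply (i.1 : ι) (hB i hi)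
  have hE : MeasurableSet {x : ι → K | ∀ i ∈ s, x i.1 ∈ B i} := by
    have : {x : ι → K | ∀ i ∈ s, x i.1 ∈ B i} = ⋂ i ∈ s, {x : ι → K | x i.1 ∈ B i} := by
      ext x; simp
    rw [this]
    exact Finset.measurableSet_biInter s hEi
  have hinter : ⋂ i ∈ s, (fun ω => X ω i.1) ⁻¹' B i = X ⁻¹' {x | ∀ i ∈ s, x i.1 ∈ B i} := by
    ext ω; simp
  have h1 := hcond hE
  have h2 : ∀ᵐ ω ∂P, ∀ i ∈ s, (P⟦(fun ω => X ω i.1) ⁻¹' B i |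
      MeasurableSpace.comap (fun ω (i : I) => X ω i) MeasurableSpace.pi⟧) ω
      = ν.real {z | X ω i.1 + z i.1 ∈ B i} := by
    rw [Finset.eventually_all]
    exact fun i hi => hcond (hEi i hi)
  rw [hinter]
  constructor
  · intro h
    filter_upwards [h, h1, h2] with ω hω hω1 hω2
    rw [Finset.prod_apply, Finset.prod_congr rfl hω2] at hω
    exact hω1.symm.trans hω
  · intro h
    filter_upwards [h, h1, h2] with ω hω hω1 hω2
    rw [Finset.prod_apply, Finset.prod_congr rfl hω2]
    exact hω1.trans hω

/-- The coordinates in `J` are conditionally independent given those in `I` if and only if the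
conditional lattice projects onto the product of its coordinate projections. -/
theorem condIndepGiven_iff_projectsOntoProduct (hX : Measurable X) {L : Submodule 𝒪[K] (ι → K)}
    (hb : HasBoundedEntries (L : Set (ι → K))) (hL : IsClosed (L : Set (ι → K)))
    (hsupp : (L : Set (ι → K)) = latticeOf X P) (hμ : IsUniformOn (P.map X) L.toAddSubgroup)
    (I : Set ι) (J : Set ↥Iᶜ) :
    CondIndepGiven P X I J ↔ ProjectsOntoProduct (fiberModule I L : Set (↥Iᶜ → K)) J := by
  have := polishSpace_of_isNonarchimedeanLocalField K
  have := Fintype.ofFinite J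
  have hLc := hb.isCompact hL
  have hf : Continuous (restrictCoords I : (ι → K) →+ (I → K)) :=
    continuous_pi fun i => continuous_apply i.1
  set N : AddSubgroup (ι → K) := L.toAddSubgroup ⊓ (restrictCoords I).ker
  have hN : IsCompact (N : Set (ι → K)) := by
    refine hLc.of_isClosed_subset ?_ fun x hx => hx.1
    exact hL.inter (isClosed_singleton.preimage hf)
  obtain ⟨ν, hνp, hν, hpos⟩ := exists_isUniformOn N hN
  rw [condIndepGiven_iff_ae hX hLc hμ I hν, projectsOntoProduct_fiberModule_iff]
  have hproj : ∀ j : J, Continuous (Pi.evalAddMonoidHom (fun _ : ι => K) j.1) := fun j =>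
    continuous_apply _
  constructor
  · intro h w hw
    -- If `w` is missed by the compact projection of `N`, so is a box around `w`: the joint
    -- probability of the box is 0 while every marginal one is positive.
    by_contra hcon
    have hcl : IsClosed ((fun (z : ι → K) (j : J) => z j.1) '' N) :=
      (hN.image (continuous_pi hproj)).isClosed
    have hwn : w ∈ ((fun (z : ι → K) (j : J) => z j.1) '' N)ᶜ := by
      rintro ⟨z, hz, rfl⟩
      exact hcon ⟨z, hz, fun _ => rfl⟩
    obtain ⟨u, hu, hsub⟩ := isOpen_pi_iff'.1 hcl.isOpen_compl w hwn
    choose γ hγ0 hγ using fun j => exists_ball_subset (hu j).1 (hu j).2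
    have hae := h Finset.univ (fun j => {y | v (y - w j) < γ j})
      fun j _ => (isOpen_valuation_sub_lt _ _).measurableSet
    have hopen : IsOpen {x : ι → K | ∀ j : J, v (x j.1) < γ j} := by
      simp only [ofPred_forall]
      refine isOpen_iInter_of_finite fun j => ?_
      have := (isOpen_valuation_sub_lt (γ j) (0 : K)).preimage (hproj j)
      simpa using this
    -- The factorization holds only for almost every `ω`. As 0 is in the support, some such `ω` has
    -- `X ω` small on `J`, and by the ultrametric inequality shifting by it preserves the box.
    have h0 : (0 : ι → K) ∈ (P.map X).support := by
      have : (0 : ι → K) ∈ (L : Set (ι → K)) := L.zero_mem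
      rwa [hsupp] at this
    have hposX := (Measure.mem_support_iff_forall _).1 h0 _ (hopen.mem_nhds (by
      intro j; simpa [zero_lt_iff] using hγ0 j))
    rw [Measure.map_apply hX hopen.measurableSet] at hposX
    obtain ⟨ω, hω, hωeq⟩ : ∃ ω, (∀ j : J, v (X ω j.1) < γ j) ∧
        ν.real {z | ∀ j ∈ (Finset.univ : Finset J), X ω j.1 + z j.1 ∈ {y | v (y - w j) < γ j}}
          = ∏ j, ν.real {z | X ω j.1 + z j.1 ∈ {y | v (y - w j) < γ j}} := by
      by_contra! hno
      have : P (X ⁻¹' {x : ι → K | ∀ j : J, v (x j.1) < γ j}) = 0 := by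
        refine measure_mono_null (fun ω hω => ?_) hae
        exact hno ω hω
      exact hposX.ne' this
    have hleft : ν.real {z | ∀ j ∈ (Finset.univ : Finset J),
        X ω j.1 + z j.1 ∈ {y | v (y - w j) < γ j}} = 0 := by
      rw [measureReal_eq_zero_iff]
      refine measure_mono_null (t := {z | ¬ z ∈ N}) (fun z hz hzN => ?_) hν.ae_mem
      refine hsub (a := fun j : J => z j.1) (fun j _ => hγ j _ ?_) ⟨z, hzN, rfl⟩
      have := (v).map_sub_lt (hz j (Finset.mem_univ j)) (hω j)
      rwa [show X ω j.1 + z j.1 - w j - X ω j.1 = z j.1 - w j by ring] at this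
    rw [hleft, eq_comm, Finset.prod_eq_zero_iff] at hωeq
    obtain ⟨j, -, hj⟩ := hωeq
    rw [measureReal_eq_zero_iff] at hj
    refine (hpos {z | X ω j.1 + z j.1 ∈ {y | v (y - w j) < γ j}} ?_ ?_).ne' hj
    · exact (isOpen_valuation_sub_lt (γ j) (w j)).preimage (continuous_const.add (hproj j))
    · obtain ⟨z, hz, hzw⟩ := hw j
      exact ⟨z, by simpa [hzw] using hω j, hz⟩
  · intro h s B hB
    have hind := hν.iIndepFun_coordinates hN hproj h
    refine Filter.Eventually.of_forall fun ω => ?_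
    have h1 := hind.measure_inter_preimage_eq_mul s (sets := fun j => (X ω j.1 + ·) ⁻¹' B j)
      fun j hj => (measurable_const_add _) (hB j hj)
    have h2 := congrArg ENNReal.toReal h1
    rw [ENNReal.toReal_prod] at h2
    convert h2 using 1
    · simp only [Measure.real]
      congr 2
      ext z
      simp
    · rfl

end CondIndep

/-! ### Assembly -/

section Main

variable {K : Type*} [Field K]

theorem span_image_comp_perm_eq_top {ι : Type*} (σ : Equiv.Perm ι) {L : Set (ι → K)}
    (hL : Submodule.span K L = ⊤) : Submodule.span K ((fun x => x ∘ σ) '' L) = ⊤ := by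
  have := Submodule.map_span (LinearMap.funLeft K K σ) L
  rw [hL, Submodule.map_top, LinearMap.range_eq_top.2
    (LinearMap.funLeft_surjective_of_injective _ _ _ σ.injective)] at this
  exact this.symm

variable [ValuativeRel K]

theorem HasBoundedEntries.map_funLeft {ι κ : Type*} (σ : κ → ι) {L : Submodule 𝒪[K] (ι → K)}
    (hL : HasBoundedEntries (L : Set (ι → K))) :
    HasBoundedEntries (L.map (LinearMap.funLeft 𝒪[K] K σ) : Set (κ → K)) := by
  obtain ⟨γ, hγ⟩ := hL
  refine ⟨γ, ?_⟩
  rintro _ ⟨x, hx, rfl⟩ i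
  exact hγ x hx (σ i)

theorem existsUnique_isHermiteFormOf [IsDiscreteValuationRing 𝒪[K]] {d : ℕ} {π : 𝒪[K]}
    {T : Set 𝒪[K]} (hπ : Irreducible π) (hT : IsResidueSystem T)
    {L : Submodule 𝒪[K] (Fin d → K)} (hb : HasBoundedEntries (L : Set (Fin d → K)))
    (hs : Submodule.span K (L : Set (Fin d → K)) = ⊤) (σ : Equiv.Perm (Fin d)) :
    ∃! A : Matrix (Fin d) (Fin d) K, IsHermiteFormOf π T (L : Set (Fin d → K)) σ A := by
  obtain ⟨A, hA, hAL⟩ := exists_isHermite_columnLattice_eq hπ hT (hb.map_funLeft σ)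
    (span_image_comp_perm_eq_top σ hs)
  exact ⟨A, ⟨hA, hAL⟩, fun B hB => hB.1.eq_of_columnLattice_eq hπ hT hA (hB.2.trans hAL.symm)⟩

end Main

end LocalFieldGaussian

end

theorem theorem2 {K : Type*} [Field K] [ValuativeRel K] [TopologicalSpace K]
    [IsNonarchimedeanLocalField K] [MeasurableSpace K] [BorelSpace K]
    {Ω : Type*} [MeasurableSpace Ω] (P : Measure Ω) [IsProbabilityMeasure P]
    {d : ℕ} (X : Ω → Fin d → K) (hX : LocalFieldGaussian.IsGaussianVector X P)
    (I : Set (Fin d)) (hI : I ≠ Set.univ) :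
    ∃ M : Matroid ↥Iᶜ,
      M.E = Set.univ ∧
      (∀ J : Set ↥Iᶜ, M.IsBase J ↔ Maximal (LocalFieldGaussian.CondIndepGiven P X I) J) ∧
      (∀ (F : Type*) [Field F], Nat.card F = Nat.card 𝓀[K] →
        LocalFieldGaussian.IsRepresentable M F) ∧
      (LocalFieldGaussian.IsNondegenerate X P →
        ∀ (π : 𝒪[K]) (T : Set 𝒪[K]) (σ : Equiv.Perm (Fin d)), Irreducible π →
          LocalFieldGaussian.IsResidueSystem T → LocalFieldGaussian.ListsFirst I σ →
          (∃! A : Matrix (Fin d) (Fin d) K,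
            LocalFieldGaussian.IsHermiteFormOf π T (LocalFieldGaussian.latticeOf X P) σ A) ∧
          ∀ A : Matrix (Fin d) (Fin d) K,
            LocalFieldGaussian.IsHermiteFormOf π T (LocalFieldGaussian.latticeOf X P) σ A →
            (∃ C : Matrix ↥Iᶜ ↥Iᶜ 𝒪[K], LocalFieldGaussian.IsRowNormalization
              (LocalFieldGaussian.lowerBlock I σ A) C) ∧
            ∀ C : Matrix ↥Iᶜ ↥Iᶜ 𝒪[K],
              LocalFieldGaussian.IsRowNormalization (LocalFieldGaussian.lowerBlock I σ A) C →
              LocalFieldGaussian.Realizes M 𝓀[K] (LocalFieldGaussian.reducedRow C)) := by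
  open LocalFieldGaussian in
  have := polishSpace_of_isNonarchimedeanLocalField K
  have := Fintype.ofFinite ↥Iᶜ
  obtain ⟨L, hsupp, hunif, hb, hcl⟩ := hX.exists_submodule
  obtain ⟨n, r, hr⟩ := exists_linearIndepOn_iff_projectsOntoProduct (hb.fiberModule (I := I))
  obtain ⟨M, hME, hM⟩ := exists_matroid_indep_iff_linearIndepOn (F := 𝓀[K]) r
  have hMc : ∀ J, M.Indep J ↔ CondIndepGiven P X I J := fun J => by
    rw [hM, hr, condIndepGiven_iff_projectsOntoProduct hX.measurable hb hcl hsupp hunif]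
  refine ⟨M, hME, fun J => ?_, fun F _ hF => ?_, fun hnd π T σ hπ hT hσ => ⟨?_, ?_⟩⟩
  · rw [Matroid.isBase_iff_maximal_indep, show M.Indep = CondIndepGiven P X I from
      funext fun J => propext (hMc J)]
  -- Finite fields of equal cardinality are isomorphic, so the representation over `𝓀[K]` transports
  -- to `F`.
  · have hfin : Finite F := Nat.finite_of_card_ne_zero (hF ▸ Nat.card_pos.ne')
    have := Fintype.ofFinite F
    have := Fintype.ofFinite 𝓀[K]
    rw [Nat.card_eq_fintype_card, Nat.card_eq_fintype_card] at hF
    exact ⟨n, _, fun J _ => (hM J).trans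
      (linearIndepOn_ringEquiv_comp_iff (FiniteField.ringEquivOfCardEq hF.symm) r J).symm⟩
  · rw [← hsupp]
    rw [IsNondegenerate, ← hsupp] at hnd
    exact existsUnique_isHermiteFormOf hπ hT hb hnd σ
  · rintro A ⟨⟨m, htri, hdiag, -⟩, hA⟩
    rw [← hsupp] at hA
    have hne : ∀ i, A i i ≠ 0 := fun i => hdiag i ▸ zpow_ne_zero _ (coe_uniformizer_ne_zero hπ)
    refine ⟨exists_isRowNormalization fun i => ⟨i, hne _⟩, fun C hC J _ => ?_⟩
    rw [hM, hr, ← columnLattice_lowerBlock hσ htri hne hA, hC.projectsOntoProduct_iff]
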